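/- Let $(\varepsilon_i)_{i\in\mathbb{Z}}$ be i.i.d. real random variables, $\mathcal{F}_i=(\ldots,\varepsilon_{i-1},\varepsilon_i)$, and let $G:[0,1]\times\mathbb{R}^\infty\to\mathbb{R}$ be measurable. Put $\zeta_i(t)=G(t,\mathcal{F}_i)$ and $X_i=X_{i,n}=G(i/n,\mathcal{F}_i)$, $1\le i\le n$. Let $\alpha\in(0,1)$, let $F(t,x)=\mathbb{P}(\zeta_i(t)\le x)$, let $Q_\alpha(t)=\inf\{x: F(t,x)\ge\alpha\}$, and let $F(t,x,\mathcal{F}_i)=\mathbb{P}(G(t,\mathcal{F}_{i+1})\le x\mid\mathcal{F}_i)$. Let $\varepsilon_0'$ be distributed as $\varepsilon_0$ and independent of $(\varepsilon_i)_{i\in\mathbb{Z}}$, and let $\mathcal{F}_k^*=(\mathcal{F}_{-1},\varepsilon_0',\varepsilon_1,\ldots,\varepsilon_k)$ for $k\ge 0$. Assume: (A1) for every $t\in[0,1]$, $\zeta_i(t)$ has a density $f(t,\cdot)$, the function $f$ is Lipschitz continuous on $[0,1]\times\mathbb{R}$, and $\inf_{t\in[0,1]}f(t,Q_\alpha(t))>0$;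 (A5) there is $\chi\in(0,1)$ such that $\sup_{(t,x)\in[0,1]\times\mathbb{R}}\big(\mathbb{E}|F(t,x,\mathcal{F}_k)-F(t,x,\mathcal{F}_k^*)|^4\big)^{1/4}=O(\chi^k)$; (B1) $\mathbf{g}:[0,1]\to\mathbb{R}^d$ is continuous and the matrix $\int_0^1\mathbf{g}(t)\mathbf{g}(t)^\top dt$ is nonsingular. Suppose that $Q_\alpha(t)=\theta_0^\top\mathbf{g}(t)$ for all $t\in[0,1]$, for some $\theta_0\in\mathbb{R}^d$. Let $\rho_\alpha(x)=\alpha x^++(1-\alpha)(-x)^+$. Then the function $\theta\mapsto\sum_{i=1}^n\rho_\alpha(X_i-\theta^\top\mathbf{g}(i/n))$ always attains its minimum over $\mathbb{R}^d$, and, for every choice of minimizers $$\hat\theta_\alpha=\hat\theta_{\alpha,n}\in\arg\min_{\theta\in\mathbb{R}^d}\sum_{i=1}^n\rho_\alpha\big(X_i-\theta^\top\mathbf{g}(i/n)\big),$$ one has $|\hat\theta_\alpha-\theta_0|=O_{\mathbb{P}}(n^{-1/2})$ as $n\to\infty$. -/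

import Mathlib

open MeasureTheory ProbabilityTheory Set Filter

noncomputable section

namespace QuantReg

variable {Ω : Type*} [MeasurableSpace Ω]

/-- `ε i`, `i ∈ ℤ`, are independent and identically distributed real random variables. -/
structure IsIID (P : Measure Ω) (ε : ℤ → Ω → ℝ) : Prop where
  measurable : ∀ i, Measurable (ε i)
  indep : iIndepFun ε P
  identDistrib : ∀ i, IdentDistrib (ε i) (ε 0) P P

/-- The shift process `𝓕_i = (…, ε_{i-1}, ε_i)`, read backwards in time:
its `j`-th coordinate is `ε_{i-j}`. -/
def past (ε : ℤ → Ω → ℝ) (i : ℤ) (ω : Ω) : ℕ → ℝ :=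
  fun j => ε (i - j) ω

/-- The coupled process `𝓕*_k = (𝓕_{-1}, ε'_0, ε_1, …, ε_k)`, on the product space `Ω × Ω`:
with `P.prod P` there, `ε'_j (ω, ω') = ε_j ω'` is an i.i.d. copy of `ε_j (ω, ω') = ε_j ω`. -/
def coupledPast (ε : ℤ → Ω → ℝ) (k : ℕ) (ω : Ω × Ω) : ℕ → ℝ :=
  fun j => if (k : ℤ) - j = 0 then ε 0 ω.2 else ε (k - j) ω.1

/-- Physical dependence measure
`δ_H(k,p) = sup_{(t,x) ∈ [0,1] × ℝ} ‖H(t,x,𝓕_k) - H(t,x,𝓕*_k)‖_p`. -/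
def physDep (P : Measure Ω) (ε : ℤ → Ω → ℝ) (H : ℝ → ℝ → (ℕ → ℝ) → ℝ)
    (k : ℕ) (p : ENNReal) : ENNReal :=
  ⨆ t ∈ Icc (0 : ℝ) 1, ⨆ x : ℝ,
    eLpNorm (fun ω : Ω × Ω => H t x (past ε k ω.1) - H t x (coupledPast ε k ω)) p (P.prod P)

/-- `H` is uniformly geometric moment contracting of order `p`:
`δ_H(k,p) = O(χ^k)` for some `χ ∈ (0,1)`. -/
def UGMC (P : Measure Ω) (ε : ℤ → Ω → ℝ) (H : ℝ → ℝ → (ℕ → ℝ) → ℝ) (p : ENNReal) : Prop :=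
  ∃ χ : ℝ, 0 < χ ∧ χ < 1 ∧ ∃ C : ℝ, ∀ k : ℕ,
    physDep P ε H k p ≤ ENNReal.ofReal (C * χ ^ k)

/-- `ζ_i(t) = G(t, 𝓕_i)`. -/
def zeta (ε : ℤ → Ω → ℝ) (G : ℝ → (ℕ → ℝ) → ℝ) (i : ℤ) (t : ℝ) (ω : Ω) : ℝ :=
  G t (past ε i ω)

/-- The conditional distribution function `F(t,x,s) = ℙ(G(t,𝓕_{i+1}) ≤ x | 𝓕_i = s)`.
The sequence `(𝓕_i, 𝓕_{i+1})` is stationary, so that it suffices to take `i = 0`. -/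
def condF (P : Measure Ω) [IsProbabilityMeasure P] (ε : ℤ → Ω → ℝ) (G : ℝ → (ℕ → ℝ) → ℝ)
    (t x : ℝ) (s : ℕ → ℝ) : ℝ :=
  (condDistrib (zeta ε G 1 t) (past ε 0) P s).real (Iic x)

/-- The distribution function `F(t,x) = ℙ(ζ_i(t) ≤ x)` (which does not depend on `i`). -/
def distF (P : Measure Ω) (ε : ℤ → Ω → ℝ) (G : ℝ → (ℕ → ℝ) → ℝ) (t x : ℝ) : ℝ :=
  P.real {ω | zeta ε G 0 t ω ≤ x}

/-- The quantile function `Q_α(t) = inf {x : F(t,x) ≥ α}`. -/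
def quantile (P : Measure Ω) (ε : ℤ → Ω → ℝ) (G : ℝ → (ℕ → ℝ) → ℝ) (α t : ℝ) : ℝ :=
  sInf {x : ℝ | α ≤ distF P ε G t x}

/-- `ζ_i(t)` has a density `f(t,·)`, jointly Lipschitz on `[0,1] × ℝ` (the choice of the norm on
`ℝ × ℝ` only affects the constant), and `inf_{t ∈ [0,1]} f(t, Q_α(t)) > 0`. -/
def CondA1 (P : Measure Ω) (ε : ℤ → Ω → ℝ) (G : ℝ → (ℕ → ℝ) → ℝ) (α : ℝ) : Prop :=
  ∃ f : ℝ → ℝ → ℝ,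
    (∀ t ∈ Icc (0 : ℝ) 1, (∀ x, 0 ≤ f t x) ∧
      P.map (zeta ε G 0 t) = volume.withDensity (fun x => ENNReal.ofReal (f t x))) ∧
    (∃ K : NNReal, LipschitzOnWith K (Function.uncurry f) (Icc (0 : ℝ) 1 ×ˢ univ)) ∧
    ∃ c : ℝ, 0 < c ∧ ∀ t ∈ Icc (0 : ℝ) 1, c ≤ f t (quantile P ε G α t)

/-- The system `F(t,x,𝓕_i)` is UGMC(4). -/
def CondA5 (P : Measure Ω) [IsProbabilityMeasure P] (ε : ℤ → Ω → ℝ)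
    (G : ℝ → (ℕ → ℝ) → ℝ) : Prop :=
  UGMC P ε (condF P ε G) 4

/-- The matrix `∫₀¹ g(t) g(t)ᵀ dt`. -/
def gram {k : ℕ} (g : ℝ → EuclideanSpace ℝ (Fin k)) : Matrix (Fin k) (Fin k) ℝ :=
  Matrix.of fun a b => ∫ t in (0 : ℝ)..1, g t a * g t b

/-- `g` is continuous on `[0,1]` and `∫₀¹ g gᵀ` is nonsingular. -/
def CondB1 {k : ℕ} (g : ℝ → EuclideanSpace ℝ (Fin k)) : Prop :=
  ContinuousOn g (Icc (0 : ℝ) 1) ∧ IsUnit (gram g)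

/-- The check function `ρ_α(x) = α x⁺ + (1-α) (-x)⁺`. -/
def rho (α x : ℝ) : ℝ :=
  α * max x 0 + (1 - α) * max (-x) 0

/-- The observations `X_{i,n} = G(i/n, 𝓕_i)`. -/
def obs (ε : ℤ → Ω → ℝ) (G : ℝ → (ℕ → ℝ) → ℝ) (n i : ℕ) (ω : Ω) : ℝ :=
  G ((i : ℝ) / n) (past ε i ω)

/-- The criterion `∑_{i=1}^n ρ_α(X_{i,n} - θᵀ g(i/n))`. -/
def criterion {k : ℕ} (ε : ℤ → Ω → ℝ) (G : ℝ → (ℕ → ℝ) → ℝ)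
    (g : ℝ → EuclideanSpace ℝ (Fin k)) (α : ℝ) (n : ℕ) (ω : Ω)
    (θ : EuclideanSpace ℝ (Fin k)) : ℝ :=
  ∑ i ∈ Finset.Icc 1 n, rho α (obs ε G n i ω - inner ℝ θ (g ((i : ℝ) / n)))

/-- `Y_n = O_ℙ(r_n)`. For a non-measurable event `P` is the outer measure, which makes the
condition stronger. -/
def IsBigOP (P : Measure Ω) (Y : ℕ → Ω → ℝ) (r : ℕ → ℝ) : Prop :=
  ∀ η : ℝ, 0 < η → ∃ M : ℝ, ∀ᶠ n in atTop,
    P {ω | M * r n < |Y n ω|} ≤ ENNReal.ofReal η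

end QuantReg

end

open MeasureTheory ProbabilityTheory Set Filter

noncomputable section

namespace QuantReg

variable {Ω : Type*} [MeasurableSpace Ω]

/-! The criterion is convex in θ. Hence, if it exceeds its value at θ₀ on the whole sphere of radius
R = M n^{-1/2} about θ₀, every minimizer lies inside (`norm_sub_le_of_isMinOn`). It remains to show
that this happens with probability close to 1 when M is large.

By Knight's identity the increment in a unit direction b is a linear term, R times the inner product
of b with `score`, plus a nonnegative integral of indicator differences. Monotonicity bounds that
integral below by half its length times the integrand at the midpoint (`rho_sub_rho_ge`), so that
only indicators at single points occur. The score has second moment O(n), so the linear term is of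
order M. The lower bound `curvature` has variance O(M²) and mean at least κM², because the density
is bounded below near the quantile curve and the design is nondegenerate. The quadratic term
therefore wins for large M. Uniformity in b needs only a finite δ-net of the unit sphere: moving b
to the net costs δRB times `kinkCount`, with mean O(δM²).

Both variance bounds rest on geometrically decaying covariances of indicators. For times i < j,
conditioning on the past at j - 1 turns the later indicator into the conditional distribution
function, which (A5) controls. The innovations at times i, i - 1, … are then replaced one by one by
independent copies. Each replacement has the joint law of the coupling in (A5), so the costs form a
geometric series, and in the limit the two factors decouple (`abs_cov_past_le`).

Minimizers exist because the criterion is coercive as a function of the fitted values, which range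
over a finite-dimensional space. -/

/-! ### Doubled i.i.d. family and couplings of pasts. -/

/-- Reindexing an i.i.d. family along injections does not change its joint law. -/
lemma identDistrib_precomp {κ ι : Type*} {P : Measure Ω} {ξ : κ → Ω → ℝ} {k₀ : κ}
    (hm : ∀ k, Measurable (ξ k)) (hi : iIndepFun ξ P)
    (hd : ∀ k, IdentDistrib (ξ k) (ξ k₀) P P) {σ τ : ι → κ}
    (hσ : Function.Injective σ) (hτ : Function.Injective τ) :
    IdentDistrib (fun ω i => ξ (σ i) ω) (fun ω i => ξ (τ i) ω) P P where
  aemeasurable_fst := (measurable_pi_lambda _ fun i => hm (σ i)).aemeasurable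
  aemeasurable_snd := (measurable_pi_lambda _ fun i => hm (τ i)).aemeasurable
  map_eq := by
    rw [(hi.precomp hσ).map_fun_eq_infinitePi_map fun i => hm (σ i),
      (hi.precomp hτ).map_fun_eq_infinitePi_map fun i => hm (τ i)]
    simp only [(hd _).map_eq]

/-- Two independent copies of `ε`, as one family on the product space. -/
def twoCopies (ε : ℤ → Ω → ℝ) : ℤ ⊕ ℤ → Ω × Ω → ℝ
  | .inl i, ω => ε i ω.1
  | .inr i, ω => ε i ω.2

lemma measurable_twoCopies {ε : ℤ → Ω → ℝ} (hε : ∀ i, Measurable (ε i)) (k : ℤ ⊕ ℤ) :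
    Measurable (twoCopies ε k) := by
  cases k with
  | inl i => exact (hε i).comp measurable_fst
  | inr i => exact (hε i).comp measurable_snd

/-- A finite intersection of events splits into a rectangle, one side for each copy, so the product
measure factorizes it. -/
lemma iIndepFun_twoCopies {P : Measure Ω} [IsProbabilityMeasure P] {ε : ℤ → Ω → ℝ}
    (hi : iIndepFun ε P) : iIndepFun (twoCopies ε) (P.prod P) := by
  rw [iIndepFun_iff_measure_inter_preimage_eq_mul] at hi ⊢
  intro S A hA
  have hset : (⋂ k ∈ S, twoCopies ε k ⁻¹' A k) =
      (⋂ i ∈ S.toLeft, ε i ⁻¹' A (.inl i)) ×ˢ (⋂ i ∈ S.toRight, ε i ⁻¹' A (.inr i)) := by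
    ext ω
    simp only [mem_iInter, mem_preimage, mem_prod, Finset.mem_toLeft, Finset.mem_toRight,
      Sum.forall, twoCopies]
  have hl : ∀ i, (P.prod P) (twoCopies ε (.inl i) ⁻¹' A (.inl i)) = P (ε i ⁻¹' A (.inl i)) := by
    intro i
    have : twoCopies ε (.inl i) ⁻¹' A (.inl i) = (ε i ⁻¹' A (.inl i)) ×ˢ univ := by
      ext ω; simp [twoCopies]
    rw [this, Measure.prod_prod, measure_univ, mul_one]
  have hr : ∀ i, (P.prod P) (twoCopies ε (.inr i) ⁻¹' A (.inr i)) = P (ε i ⁻¹' A (.inr i)) := by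
    intro i
    have : twoCopies ε (.inr i) ⁻¹' A (.inr i) = univ ×ˢ (ε i ⁻¹' A (.inr i)) := by
      ext ω; simp [twoCopies]
    rw [this, Measure.prod_prod, measure_univ, one_mul]
  rw [hset, Measure.prod_prod, hi S.toLeft fun i hi => hA _ (Finset.mem_toLeft.1 hi),
    hi S.toRight fun i hi => hA _ (Finset.mem_toRight.1 hi)]
  conv_rhs => rw [← Finset.toLeft_disjSum_toRight (u := S), Finset.prod_disjSum]
  simp only [hl, hr]

lemma identDistrib_twoCopies {P : Measure Ω} [IsProbabilityMeasure P] {ε : ℤ → Ω → ℝ}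
    (hε : IsIID P ε) (k : ℤ ⊕ ℤ) :
    IdentDistrib (twoCopies ε k) (twoCopies ε (.inl 0)) (P.prod P) (P.prod P) := by
  have h1 : ∀ i, (P.prod P).map (twoCopies ε (.inl i)) = P.map (ε i) := by
    intro i
    have : twoCopies ε (.inl i) = ε i ∘ Prod.fst := rfl
    rw [this, ← Measure.map_map (hε.measurable i) measurable_fst, Measure.map_fst_prod]
    simp
  have h2 : ∀ i, (P.prod P).map (twoCopies ε (.inr i)) = P.map (ε i) := by
    intro i
    have : twoCopies ε (.inr i) = ε i ∘ Prod.snd := rfl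
    rw [this, ← Measure.map_map (hε.measurable i) measurable_snd, Measure.map_snd_prod]
    simp
  refine ⟨(measurable_twoCopies hε.measurable k).aemeasurable,
    (measurable_twoCopies hε.measurable _).aemeasurable, ?_⟩
  rw [h1]
  cases k with
  | inl i => rw [h1, (hε.identDistrib i).map_eq]
  | inr i => rw [h2, (hε.identDistrib i).map_eq]

lemma measurable_past {ε : ℤ → Ω → ℝ} (hε : ∀ i, Measurable (ε i)) (i : ℤ) :
    Measurable (past ε i) :=
  measurable_pi_lambda _ fun _ => hε _

lemma identDistrib_past {P : Measure Ω} {ε : ℤ → Ω → ℝ} (hε : IsIID P ε) (i j : ℤ) :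
    IdentDistrib (past ε i) (past ε j) P P :=
  identDistrib_precomp (σ := fun m : ℕ => i - m) (τ := fun m : ℕ => j - m)
    hε.measurable hε.indep hε.identDistrib
    (fun a b h => by simpa using h) (fun a b h => by simpa using h)

/-- The past of time `d` in which the innovations at the `L` times `0, -1, …, -L + 1` are replaced
by independent copies. -/
def replacedPast (ε : ℤ → Ω → ℝ) (d L : ℕ) (ω : Ω × Ω) : ℕ → ℝ :=
  fun j => if d ≤ j ∧ j < d + L then ε (d - j) ω.2 else ε (d - j) ω.1

/-- The index in the doubled family of the `j`-th coordinate of `replacedPast`. -/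
def replacedIndex (d L j : ℕ) : ℤ ⊕ ℤ :=
  if d ≤ j ∧ j < d + L then .inr (d - j) else .inl (d - j)

lemma replacedPast_eq {Ω : Type*} (ε : ℤ → Ω → ℝ) (d L : ℕ) (ω : Ω × Ω) :
    replacedPast ε d L ω = fun j => twoCopies ε (replacedIndex d L j) ω := by
  funext j
  simp only [replacedPast, replacedIndex]
  split_ifs <;> rfl

lemma replacedIndex_injective (d L : ℕ) : Function.Injective (replacedIndex d L) := by
  intro a b h
  simp only [replacedIndex] at h
  split_ifs at h <;> simp at h <;> omega

lemma measurable_replacedPast {ε : ℤ → Ω → ℝ} (hε : ∀ i, Measurable (ε i)) (d L : ℕ) :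
    Measurable (replacedPast ε d L) := by
  have : replacedPast ε d L = fun ω j => twoCopies ε (replacedIndex d L j) ω :=
    funext (replacedPast_eq ε d L)
  rw [this]
  exact measurable_pi_lambda _ fun _ => measurable_twoCopies hε _

/-- Replacing one more innovation has the law of the coupling of the physical dependence measure. -/
lemma identDistrib_replacedPast_succ {P : Measure Ω} [IsProbabilityMeasure P] {ε : ℤ → Ω → ℝ}
    (hε : IsIID P ε) (d L : ℕ) :
    IdentDistrib (fun ω => (replacedPast ε d L ω, replacedPast ε d (L + 1) ω))
      (fun ω => (past ε ((d + L : ℕ) : ℤ) ω.1, coupledPast ε (d + L) ω))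
      (P.prod P) (P.prod P) := by
  -- `none` labels the innovation about to enter at coordinate d + L, and `some j` the current
  -- coordinates. Both pairs of sequences are then the same function Φ of an injectively indexed
  -- i.i.d. family.
  let σ : Option ℕ → ℤ ⊕ ℤ := fun o => o.elim (.inr (-(L : ℤ))) (replacedIndex d L)
  let τ : Option ℕ → ℤ ⊕ ℤ := fun o => o.elim (.inr 0) fun j => .inl (((d + L : ℕ) : ℤ) - j)
  have hσ : Function.Injective σ := by
    intro a b h
    cases a with
    | none =>
      cases b with
      | none => rfl
      | some b =>
        simp only [σ, Option.elim, replacedIndex] at h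
        split_ifs at h
        simp at h; omega
    | some a =>
      cases b with
      | none =>
        simp only [σ, Option.elim, replacedIndex] at h
        split_ifs at h
        simp at h; omega
      | some b => exact congrArg some (replacedIndex_injective d L h)
  have hτ : Function.Injective τ := by
    intro a b h
    cases a <;> cases b <;> simp [τ] at h ⊢
    exact h
  let Φ : (Option ℕ → ℝ) → (ℕ → ℝ) × (ℕ → ℝ) := fun z =>
    (fun j => z (some j), fun j => if j = d + L then z none else z (some j))
  have hΦ : Measurable Φ := by
    refine Measurable.prodMk (measurable_pi_lambda _ fun j => measurable_pi_apply _)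
      (measurable_pi_lambda _ fun j => ?_)
    by_cases hj : j = d + L
    · simpa [hj] using measurable_pi_apply _
    · simpa [hj] using measurable_pi_apply _
  have h := (identDistrib_precomp (measurable_twoCopies hε.measurable)
    (iIndepFun_twoCopies hε.indep) (identDistrib_twoCopies hε) hσ hτ).comp hΦ
  convert h using 1
  · funext ω
    refine Prod.ext (replacedPast_eq ε d L ω) ?_
    funext j
    simp only [Φ, Function.comp, σ, Option.elim]
    by_cases hj : j = d + L
    · subst hj
      simp [replacedPast, twoCopies]
    · rw [if_neg hj, ← congrFun (replacedPast_eq ε d L ω) j]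
      simp only [replacedPast]
      by_cases h1 : d ≤ j ∧ j < d + L
      · rw [if_pos h1, if_pos (by omega)]
      · rw [if_neg h1, if_neg (by omega)]
  · funext ω
    refine Prod.ext rfl ?_
    funext j
    simp only [Φ, Function.comp, τ, Option.elim, coupledPast]
    by_cases hj : j = d + L
    · subst hj
      simp [twoCopies]
    · rw [if_neg hj, if_neg (by omega)]
      rfl

/-- Replacement only changes which distinct members of the doubled family are read, so the mean of a
function of the past is unaffected by L. -/
lemma identDistrib_replacedPast {P : Measure Ω} [IsProbabilityMeasure P] {ε : ℤ → Ω → ℝ}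
    (hε : IsIID P ε) (d L : ℕ) :
    IdentDistrib (replacedPast ε d L) (fun ω => past ε d ω.1) (P.prod P) (P.prod P) := by
  have h := identDistrib_precomp (measurable_twoCopies hε.measurable)
    (iIndepFun_twoCopies hε.indep) (identDistrib_twoCopies hε) (replacedIndex_injective d L)
    (τ := fun j : ℕ => .inl ((d : ℤ) - j)) (fun a b h => by simpa using h)
  have hl : replacedPast ε d L = fun ω j => twoCopies ε (replacedIndex d L j) ω :=
    funext (replacedPast_eq ε d L)
  rw [hl]
  exact h

lemma integral_comp_fst_prod {P : Measure Ω} [IsProbabilityMeasure P] (f : Ω → ℝ) :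
    ∫ ω, f ω.1 ∂(P.prod P) = ∫ ω, f ω ∂P := by
  simpa using integral_fun_fst (μ := P) (ν := P) f

/-- One replacement changes `H` by at most the physical dependence, in mean. -/
lemma integral_abs_sub_replacedPast_le {P : Measure Ω} [IsProbabilityMeasure P] {ε : ℤ → Ω → ℝ}
    (hε : IsIID P ε) {H : (ℕ → ℝ) → ℝ} (hH : Measurable H)
    {d L : ℕ} {D : ℝ} (hD : 0 ≤ D)
    (hdep : eLpNorm (fun ω : Ω × Ω => H (past ε ((d + L : ℕ) : ℤ) ω.1) -
      H (coupledPast ε (d + L) ω)) 4 (P.prod P) ≤ ENNReal.ofReal D) :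
    ∫ ω, |H (replacedPast ε d L ω) - H (replacedPast ε d (L + 1) ω)| ∂(P.prod P) ≤ D := by
  have hm : Measurable fun z : (ℕ → ℝ) × (ℕ → ℝ) => H z.1 - H z.2 :=
    (hH.comp measurable_fst).sub (hH.comp measurable_snd)
  have hid := (identDistrib_replacedPast_succ hε d L).comp hm
  have h4 := hid.eLpNorm_eq (p := 4)
  have hmeas : Measurable fun ω : Ω × Ω =>
      H (replacedPast ε d L ω) - H (replacedPast ε d (L + 1) ω) :=
    (hH.comp (measurable_replacedPast hε.measurable d L)).sub
      (hH.comp (measurable_replacedPast hε.measurable d (L + 1)))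
  have h1 : eLpNorm (fun ω : Ω × Ω => H (replacedPast ε d L ω) - H (replacedPast ε d (L + 1) ω)) 1
      (P.prod P) ≤ ENNReal.ofReal D :=
    (eLpNorm_le_eLpNorm_of_exponent_le (by norm_num) hmeas.aestronglyMeasurable).trans
      (h4.trans_le hdep)
  rw [eLpNorm_one_eq_lintegral_enorm] at h1
  have : ∫ ω, |H (replacedPast ε d L ω) - H (replacedPast ε d (L + 1) ω)| ∂(P.prod P) =
      (∫⁻ ω, ‖H (replacedPast ε d L ω) - H (replacedPast ε d (L + 1) ω)‖ₑ ∂(P.prod P)).toReal :=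
    integral_norm_eq_lintegral_enorm hmeas.aestronglyMeasurable
  rw [this]
  exact ENNReal.toReal_le_of_le_ofReal hD h1

/-! ### Decoupling and the covariance inequality. -/

/-- The times `0, -1, …, -L + 1` of the first copy. -/
def recentIndices (L : ℕ) : Set (ℤ ⊕ ℤ) := {k | ∃ j : ℕ, j < L ∧ k = .inl (-(j : ℤ))}

/-- The filtration generated by the innovations at the times `0, -1, …, -L + 1`. -/
def recentFiltration {ε : ℤ → Ω → ℝ} (hε : ∀ i, Measurable (ε i)) :
    Filtration ℕ (inferInstance : MeasurableSpace (Ω × Ω)) where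
  seq L := ⨆ k ∈ recentIndices L, MeasurableSpace.comap (twoCopies ε k) inferInstance
  mono' L L' hL := by
    refine biSup_mono ?_
    rintro k ⟨j, hj, rfl⟩
    exact ⟨j, hj.trans_le hL, rfl⟩
  le' L := iSup₂_le fun k _ => (measurable_twoCopies hε k).comap_le

/-- Each coordinate is revealed at some finite stage L. This identifies the limit in the martingale
convergence theorem with the variable itself. -/
lemma measurable_past_iSup_recentFiltration {ε : ℤ → Ω → ℝ} (hε : ∀ i, Measurable (ε i)) :
    Measurable[⨆ L, recentFiltration hε L] fun ω : Ω × Ω => past ε 0 ω.1 := by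
  refine @measurable_pi_lambda _ _ _ (⨆ L, recentFiltration hε L) _ _ fun j => ?_
  have h1 : MeasurableSpace.comap (twoCopies ε (.inl (-(j : ℤ)))) inferInstance ≤
      ⨆ L, (recentFiltration hε L : MeasurableSpace (Ω × Ω)) :=
    (le_iSup₂_of_le (f := fun k (_ : k ∈ recentIndices (j + 1)) =>
      MeasurableSpace.comap (twoCopies ε k) inferInstance) (.inl (-(j : ℤ)))
      ⟨j, Nat.lt_succ_self j, rfl⟩ le_rfl).trans (le_iSup (fun L => (recentFiltration hε L :
        MeasurableSpace (Ω × Ω))) (j + 1))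
  have h2 : (fun ω : Ω × Ω => past ε 0 ω.1 j) = twoCopies ε (.inl (-(j : ℤ))) := by
    funext ω; simp [past, twoCopies]
  rw [h2]
  exact measurable_iff_comap_le.2 h1

/-- The first-copy innovations at times 0, …, -L + 1 are exactly those that have been replaced, so
none of them is read. -/
lemma measurable_replacedPast_compl {Ω : Type*} {ε : ℤ → Ω → ℝ} (d L : ℕ) :
    Measurable[⨆ k ∈ (recentIndices L)ᶜ, MeasurableSpace.comap (twoCopies ε k) inferInstance]
      (replacedPast ε d L) := by
  have hl : replacedPast ε d L = fun ω j => twoCopies ε (replacedIndex d L j) ω :=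
    funext (replacedPast_eq ε d L)
  rw [hl]
  refine @measurable_pi_lambda _ _ _ (_) _ _ fun j => ?_
  refine measurable_iff_comap_le.2 (le_iSup₂_of_le (f := fun k (_ : k ∈ (recentIndices L)ᶜ) =>
      MeasurableSpace.comap (twoCopies ε k) inferInstance) (replacedIndex d L j) ?_ le_rfl)
  rintro ⟨i, hi, h⟩
  simp only [replacedIndex] at h
  split_ifs at h with hc
  simp at h
  omega

/-- Functions of the innovations `0, …, -L + 1` are independent of the past in which exactly these
innovations are replaced. -/
lemma integral_mul_replacedPast {P : Measure Ω} [IsProbabilityMeasure P] {ε : ℤ → Ω → ℝ}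
    (hε : IsIID P ε) {H : (ℕ → ℝ) → ℝ} (hH : Measurable H) (d L : ℕ) {ψ : Ω × Ω → ℝ}
    (hψ : StronglyMeasurable[recentFiltration hε.measurable L] ψ) :
    ∫ ω, ψ ω * H (replacedPast ε d L ω) ∂(P.prod P) =
      (∫ ω, ψ ω ∂(P.prod P)) * ∫ ω, H (replacedPast ε d L ω) ∂(P.prod P) := by
  have hind := indep_iSup_of_disjoint
    (fun k => (measurable_twoCopies hε.measurable k).comap_le) (iIndepFun_twoCopies hε.indep)
    (disjoint_compl_right (a := recentIndices L))
  have h2 : Measurable[⨆ k ∈ (recentIndices L)ᶜ,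
      MeasurableSpace.comap (twoCopies ε k) inferInstance]
      (fun ω => H (replacedPast ε d L ω)) := hH.comp (measurable_replacedPast_compl d L)
  have hfun : IndepFun ψ (fun ω => H (replacedPast ε d L ω)) (P.prod P) := by
    rw [IndepFun_iff_Indep]
    exact indep_of_indep_of_le_left (indep_of_indep_of_le_right hind
      (measurable_iff_comap_le.1 h2)) (measurable_iff_comap_le.1 hψ.measurable)
  exact hfun.integral_fun_mul_eq_mul_integral
    (hψ.mono ((recentFiltration hε.measurable).le L)).aestronglyMeasurable
    (hH.comp (measurable_replacedPast hε.measurable d L)).aestronglyMeasurable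

lemma integrable_of_abs_le {P : Measure Ω} [IsFiniteMeasure P] {f : Ω → ℝ} (hf : Measurable f)
    {B : ℝ} (h : ∀ ω, |f ω| ≤ B) : Integrable f P :=
  Integrable.of_bound hf.aestronglyMeasurable B (Eventually.of_forall h)

/-- Covariance inequality for functions of the past with geometrically decaying physical
dependence. -/
lemma abs_cov_past_le {P : Measure Ω} [IsProbabilityMeasure P] {ε : ℤ → Ω → ℝ}
    (hε : IsIID P ε) {φ H : (ℕ → ℝ) → ℝ} (hφ : Measurable φ) (hH : Measurable H)
    (hφ1 : ∀ s, |φ s| ≤ 1) (hH1 : ∀ s, |H s| ≤ 1) {C χ : ℝ} (hC : 0 ≤ C) (hχ0 : 0 ≤ χ)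
    (hχ1 : χ < 1)
    (hdep : ∀ k : ℕ, eLpNorm (fun ω : Ω × Ω => H (past ε k ω.1) - H (coupledPast ε k ω)) 4
      (P.prod P) ≤ ENNReal.ofReal (C * χ ^ k)) (d : ℕ) :
    |∫ ω, φ (past ε 0 ω) * H (past ε d ω) ∂P -
      (∫ ω, φ (past ε 0 ω) ∂P) * ∫ ω, H (past ε d ω) ∂P| ≤ C / (1 - χ) * χ ^ d := by
  set μ := P.prod P
  set Y : Ω × Ω → ℝ := fun ω => φ (past ε 0 ω.1) with hY
  set W : ℕ → Ω × Ω → ℝ := fun L ω => H (replacedPast ε d L ω) with hW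
  have hYm : Measurable Y := hφ.comp ((measurable_past hε.measurable 0).comp measurable_fst)
  have hWm : ∀ L, Measurable (W L) := fun L => hH.comp (measurable_replacedPast hε.measurable d L)
  have hY1 : ∀ ω, |Y ω| ≤ 1 := fun ω => hφ1 _
  have hW1 : ∀ L ω, |W L ω| ≤ 1 := fun L ω => hH1 _
  have hYi : Integrable Y μ := integrable_of_abs_le hYm hY1
  have hWi : ∀ L, Integrable (W L) μ := fun L => integrable_of_abs_le (hWm L) (hW1 L)
  have hYW : ∀ L, Integrable (fun ω => Y ω * W L ω) μ := fun L =>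
    integrable_of_abs_le (hYm.mul (hWm L)) (B := 1) fun ω => by
      rw [abs_mul]; exact mul_le_one₀ (hY1 ω) (abs_nonneg _) (hW1 L ω)
  have hW0 : ∀ ω, W 0 ω = H (past ε d ω.1) := by
    intro ω
    simp only [hW]
    congr 1
    funext j
    simp only [replacedPast, past]
    rw [if_neg (by omega)]
  have hmean : ∀ L, ∫ ω, W L ω ∂μ = ∫ ω, H (past ε d ω) ∂P := by
    intro L
    rw [← integral_comp_fst_prod (P := P) fun ω => H (past ε d ω)]
    exact ((identDistrib_replacedPast hε d L).comp hH).integral_eq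
  have hYmean : ∫ ω, Y ω ∂μ = ∫ ω, φ (past ε 0 ω) ∂P :=
    integral_comp_fst_prod fun ω => φ (past ε 0 ω)
  have hprod : ∫ ω, φ (past ε 0 ω) * H (past ε d ω) ∂P = ∫ ω, Y ω * W 0 ω ∂μ := by
    rw [← integral_comp_fst_prod (P := P) fun ω => φ (past ε 0 ω) * H (past ε d ω)]
    simp only [hW0, hY, μ]
  have hstep : ∀ L, |∫ ω, Y ω * W L ω ∂μ - ∫ ω, Y ω * W (L + 1) ω ∂μ| ≤ C * χ ^ (d + L) := by
    intro L
    rw [← integral_sub (hYW L) (hYW (L + 1))]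
    refine (abs_integral_le_integral_abs).trans ?_
    refine le_trans ?_ (integral_abs_sub_replacedPast_le hε hH (d := d) (L := L)
      (D := C * χ ^ (d + L)) (by positivity) (hdep (d + L)))
    refine integral_mono ((hYW L).sub (hYW (L + 1))).abs ((hWi L).sub (hWi (L + 1))).abs fun ω => ?_
    change |Y ω * W L ω - Y ω * W (L + 1) ω| ≤ |W L ω - W (L + 1) ω|
    rw [← mul_sub, abs_mul]
    exact mul_le_of_le_one_left (abs_nonneg _) (hY1 ω)
  have htel : ∀ L, |∫ ω, Y ω * W 0 ω ∂μ - ∫ ω, Y ω * W L ω ∂μ| ≤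
      ∑ l ∈ Finset.range L, C * χ ^ (d + l) := by
    intro L
    induction L with
    | zero => simp
    | succ L ih =>
      rw [Finset.sum_range_succ]
      exact (abs_sub_le _ _ _).trans (add_le_add ih (hstep L))
  have hgeom : ∀ L, ∑ l ∈ Finset.range L, C * χ ^ (d + l) ≤ C / (1 - χ) * χ ^ d := by
    intro L
    have h1 : ∑ l ∈ Finset.range L, χ ^ l ≤ (1 - χ)⁻¹ := by
      rw [← tsum_geometric_of_lt_one hχ0 hχ1]
      exact (summable_geometric_of_lt_one hχ0 hχ1).sum_le_tsum _ fun l _ => pow_nonneg hχ0 l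
    calc ∑ l ∈ Finset.range L, C * χ ^ (d + l) = C * χ ^ d * ∑ l ∈ Finset.range L, χ ^ l := by
          rw [Finset.mul_sum]; exact Finset.sum_congr rfl fun l _ => by ring
      _ ≤ C * χ ^ d * (1 - χ)⁻¹ := by gcongr
      _ = _ := by ring
  -- Y may depend on infinitely many innovations, whereas the replaced past is independent only of
  -- the L most recent ones. Conditioning Y on these restores independence, and Lévy's upward
  -- theorem makes the error vanish in L¹ as L → ∞.
  set ψ : ℕ → Ω × Ω → ℝ := fun L => μ[Y | recentFiltration hε.measurable L]
  have hlim : Tendsto (fun L => eLpNorm (ψ L - Y) 1 μ) atTop (nhds 0) :=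
    hYi.tendsto_eLpNorm_condExp
      ((hφ.comp (measurable_past_iSup_recentFiltration hε.measurable)).stronglyMeasurable)
  have hlim' : Tendsto (fun L => ∫ ω, |ψ L ω - Y ω| ∂μ) atTop (nhds 0) := by
    have h := (ENNReal.tendsto_toReal ENNReal.zero_ne_top).comp hlim
    refine h.congr fun L => ?_
    simp only [Function.comp, eLpNorm_one_eq_lintegral_enorm]
    exact (integral_norm_eq_lintegral_enorm
      (integrable_condExp.sub hYi).aestronglyMeasurable).symm
  have hψi : ∀ L, Integrable (ψ L) μ := fun L => integrable_condExp
  have hrem : ∀ L, |∫ ω, Y ω * W L ω ∂μ - (∫ ω, Y ω ∂μ) * ∫ ω, H (past ε d ω) ∂P| ≤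
      ∫ ω, |ψ L ω - Y ω| ∂μ := by
    intro L
    have h1 : ∫ ω, ψ L ω * W L ω ∂μ = (∫ ω, ψ L ω ∂μ) * ∫ ω, W L ω ∂μ :=
      integral_mul_replacedPast hε hH d L stronglyMeasurable_condExp
    have h2 : ∫ ω, ψ L ω ∂μ = ∫ ω, Y ω ∂μ :=
      integral_condExp ((recentFiltration hε.measurable).le L)
    have hψW : Integrable (fun ω => ψ L ω * W L ω) μ :=
      (hψi L).mul_bdd (c := 1) (hWm L).aestronglyMeasurable (Eventually.of_forall (hW1 L))
    rw [h2, hmean] at h1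
    rw [← h1, ← integral_sub (hYW L) hψW]
    refine (abs_integral_le_integral_abs).trans ?_
    refine integral_mono ((hYW L).sub hψW).abs ((hψi L).sub hYi).abs fun ω => ?_
    change |Y ω * W L ω - ψ L ω * W L ω| ≤ |ψ L ω - Y ω|
    rw [← sub_mul, abs_mul, abs_sub_comm]
    exact mul_le_of_le_one_right (abs_nonneg _) (hW1 L ω)
  rw [hprod, ← hYmean]
  refine ge_of_tendsto' (f := fun L => C / (1 - χ) * χ ^ d + ∫ ω, |ψ L ω - Y ω| ∂μ) (x := atTop)
    (by simpa using hlim'.const_add (C / (1 - χ) * χ ^ d)) fun L => ?_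
  exact (abs_sub_le _ _ _).trans (add_le_add ((htel L).trans (hgeom L)) (hrem L))

/-! ### Centred indicators: covariances and second moments. -/

/-- The centred indicator `1{ζ_i(t) ≤ x} - F(t,x)`. -/
def centredInd (P : Measure Ω) (ε : ℤ → Ω → ℝ) (G : ℝ → (ℕ → ℝ) → ℝ) (i : ℤ) (t x : ℝ) (ω : Ω) :
    ℝ :=
  (Iic x).indicator 1 (zeta ε G i t ω) - distF P ε G t x

lemma measurable_indicator_Iic (x : ℝ) : Measurable ((Iic x).indicator (1 : ℝ → ℝ)) :=
  measurable_one.indicator measurableSet_Iic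

lemma indicator_Iic_mem (x y : ℝ) : (Iic x).indicator (1 : ℝ → ℝ) y ∈ Icc (0 : ℝ) 1 := by
  by_cases h : y ∈ Iic x <;> simp [h]

lemma measurable_zeta {ε : ℤ → Ω → ℝ} (hε : ∀ i, Measurable (ε i)) {G : ℝ → (ℕ → ℝ) → ℝ} {t : ℝ}
    (hG : Measurable (G t)) (i : ℤ) : Measurable (zeta ε G i t) :=
  hG.comp (measurable_past hε i)

lemma measurable_centredInd {P : Measure Ω} {ε : ℤ → Ω → ℝ} (hε : ∀ i, Measurable (ε i))
    {G : ℝ → (ℕ → ℝ) → ℝ} {t : ℝ} (hG : Measurable (G t)) (i : ℤ) (x : ℝ) :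
    Measurable (centredInd P ε G i t x) :=
  ((measurable_indicator_Iic x).comp (measurable_zeta hε hG i)).sub_const _

lemma distF_mem {P : Measure Ω} [IsProbabilityMeasure P] (ε : ℤ → Ω → ℝ) (G : ℝ → (ℕ → ℝ) → ℝ)
    (t x : ℝ) : distF P ε G t x ∈ Icc (0 : ℝ) 1 :=
  ⟨measureReal_nonneg, measureReal_le_one⟩

lemma abs_centredInd_le {P : Measure Ω} [IsProbabilityMeasure P] (ε : ℤ → Ω → ℝ)
    (G : ℝ → (ℕ → ℝ) → ℝ) (i : ℤ) (t x : ℝ) (ω : Ω) : |centredInd P ε G i t x ω| ≤ 1 := by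
  have h1 := indicator_Iic_mem x (zeta ε G i t ω)
  have h2 := distF_mem (P := P) ε G t x
  rw [centredInd, abs_le]
  constructor <;> linarith [h1.1, h1.2, h2.1, h2.2]

lemma integrable_indicator_zeta {P : Measure Ω} [IsProbabilityMeasure P] {ε : ℤ → Ω → ℝ}
    (hε : ∀ i, Measurable (ε i)) {G : ℝ → (ℕ → ℝ) → ℝ} {t : ℝ} (hG : Measurable (G t)) (i : ℤ)
    (x : ℝ) : Integrable (fun ω => (Iic x).indicator (1 : ℝ → ℝ) (zeta ε G i t ω)) P :=
  integrable_of_abs_le ((measurable_indicator_Iic x).comp (measurable_zeta hε hG i)) (B := 1)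
    fun ω => by
      have h := indicator_Iic_mem x (zeta ε G i t ω)
      rw [abs_of_nonneg h.1]; exact h.2

lemma integral_indicator_zeta {P : Measure Ω} [IsProbabilityMeasure P] {ε : ℤ → Ω → ℝ}
    (hε : IsIID P ε) {G : ℝ → (ℕ → ℝ) → ℝ} {t : ℝ} (hG : Measurable (G t)) (i : ℤ) (x : ℝ) :
    ∫ ω, (Iic x).indicator 1 (zeta ε G i t ω) ∂P = distF P ε G t x := by
  have h0 : ∫ ω, (Iic x).indicator 1 (zeta ε G i t ω) ∂P =
      ∫ ω, (Iic x).indicator 1 (zeta ε G 0 t ω) ∂P :=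
    (((identDistrib_past hε i 0).comp hG).comp (measurable_indicator_Iic x)).integral_eq
  rw [h0]
  exact integral_indicator_one ((measurable_zeta hε.measurable hG 0) measurableSet_Iic)

lemma measurable_condF {P : Measure Ω} [IsProbabilityMeasure P] (ε : ℤ → Ω → ℝ)
    (G : ℝ → (ℕ → ℝ) → ℝ) (t x : ℝ) : Measurable (condF P ε G t x) :=
  (Kernel.measurable_coe _ measurableSet_Iic).ennreal_toReal

lemma condF_mem {P : Measure Ω} [IsProbabilityMeasure P] (ε : ℤ → Ω → ℝ)
    (G : ℝ → (ℕ → ℝ) → ℝ) (t x : ℝ) (s : ℕ → ℝ) : condF P ε G t x s ∈ Icc (0 : ℝ) 1 :=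
  ⟨measureReal_nonneg, measureReal_le_one⟩

/-- Conditioning on the past: the indicator of `ζ_1(t) ≤ y` may be replaced by `F(t,y,𝓕_0)`. -/
lemma integral_mul_indicator_zeta {P : Measure Ω} [IsProbabilityMeasure P] {ε : ℤ → Ω → ℝ}
    (hε : IsIID P ε) {G : ℝ → (ℕ → ℝ) → ℝ} {t : ℝ} (hG : Measurable (G t)) (y : ℝ)
    {B : (ℕ → ℝ) → ℝ} (hB : Measurable B) (hB1 : ∀ s, |B s| ≤ 1) :
    ∫ ω, B (past ε 0 ω) * (Iic y).indicator 1 (zeta ε G 1 t ω) ∂P =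
      ∫ ω, B (past ε 0 ω) * condF P ε G t y (past ε 0 ω) ∂P := by
  have hp := measurable_past hε.measurable 0
  have hz := measurable_zeta hε.measurable hG 1
  have hBi : StronglyMeasurable[MeasurableSpace.comap (past ε 0) inferInstance]
      (fun ω => B (past ε 0 ω)) :=
    (hB.comp (comap_measurable _)).stronglyMeasurable
  have hind := integrable_indicator_zeta (P := P) hε.measurable hG 1 y
  have hprod : Integrable (fun ω => B (past ε 0 ω) *
      (Iic y).indicator (1 : ℝ → ℝ) (zeta ε G 1 t ω)) P :=
    hind.bdd_mul (c := 1) (hB.comp hp).aestronglyMeasurable (Eventually.of_forall fun ω => hB1 _)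
  have h1 := condExp_mul_of_stronglyMeasurable_left hBi hprod hind
  rw [← integral_condExp hp.comap_le]
  refine integral_congr_ae ?_
  have h2 := condDistrib_ae_eq_condExp (μ := P) hp hz (measurableSet_Iic (a := y))
  filter_upwards [h1, h2] with ω h1 h2
  refine h1.trans ?_
  simp only [Pi.mul_apply]
  congr 1
  exact h2.symm

/-- Covariances of centred indicators decay geometrically. -/
lemma abs_integral_centredInd_mul_le {P : Measure Ω} [IsProbabilityMeasure P] {ε : ℤ → Ω → ℝ}
    (hε : IsIID P ε) {G : ℝ → (ℕ → ℝ) → ℝ} {C χ : ℝ} (hC : 0 ≤ C) (hχ0 : 0 ≤ χ) (hχ1 : χ < 1)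
    {s t : ℝ} (hs : Measurable (G s)) (ht : Measurable (G t)) (x y : ℝ)
    (hdep : ∀ k : ℕ, eLpNorm (fun ω : Ω × Ω => condF P ε G t y (past ε k ω.1) -
      condF P ε G t y (coupledPast ε k ω)) 4 (P.prod P) ≤ ENNReal.ofReal (C * χ ^ k))
    (i : ℤ) (d : ℕ) :
    |∫ ω, centredInd P ε G i s x ω * centredInd P ε G (i + (d + 1)) t y ω ∂P| ≤
      C / (1 - χ) * χ ^ d := by
  have hi1 := integrable_indicator_zeta (P := P) hε.measurable hs i x
  have hi2 := integrable_indicator_zeta (P := P) hε.measurable ht (i + (d + 1)) y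
  have hbd : ∀ (x : ℝ) z, |(Iic x).indicator (1 : ℝ → ℝ) z| ≤ 1 := fun x z => by
    rw [abs_of_nonneg (indicator_Iic_mem x z).1]; exact (indicator_Iic_mem x z).2
  have hi12 : Integrable (fun ω => (Iic x).indicator (1 : ℝ → ℝ) (zeta ε G i s ω) *
      (Iic y).indicator (1 : ℝ → ℝ) (zeta ε G (i + (d + 1)) t ω)) P :=
    hi2.bdd_mul (c := 1) hi1.aestronglyMeasurable (Eventually.of_forall fun ω => hbd _ _)
  have hexp : ∫ ω, centredInd P ε G i s x ω * centredInd P ε G (i + (d + 1)) t y ω ∂P =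
      ∫ ω, (Iic x).indicator 1 (zeta ε G i s ω) *
        (Iic y).indicator 1 (zeta ε G (i + (d + 1)) t ω) ∂P
        - distF P ε G s x * distF P ε G t y := by
    have : ∀ ω, centredInd P ε G i s x ω * centredInd P ε G (i + (d + 1)) t y ω =
        (Iic x).indicator 1 (zeta ε G i s ω) * (Iic y).indicator 1 (zeta ε G (i + (d + 1)) t ω)
        - distF P ε G t y * (Iic x).indicator 1 (zeta ε G i s ω)
        - distF P ε G s x * (Iic y).indicator 1 (zeta ε G (i + (d + 1)) t ω)
        + distF P ε G s x * distF P ε G t y := fun ω => by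
      simp only [centredInd]; ring
    simp_rw [this]
    rw [integral_add, integral_sub, integral_sub, integral_const_mul, integral_const_mul,
      integral_indicator_zeta hε hs, integral_indicator_zeta hε ht]
    · simp
      ring
    · exact hi12
    · exact hi1.const_mul _
    · exact hi12.sub (hi1.const_mul _)
    · exact hi2.const_mul _
    · exact (hi12.sub (hi1.const_mul _)).sub (hi2.const_mul _)
    · exact integrable_const _
  -- Dropping the first m coordinates of a past goes back m time steps. Both indicators thus become
  -- functions of one past, and stationarity of that past shifts their product in time.
  have hsh : ∀ m : ℕ, Measurable fun z : ℕ → ℝ => fun j => z (j + m) := fun m =>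
    measurable_pi_lambda _ fun j => measurable_pi_apply _
  have hA : Measurable fun z : ℕ → ℝ => (Iic x).indicator (1 : ℝ → ℝ) (G s fun j => z (j + (d + 1)))
      * (Iic y).indicator (1 : ℝ → ℝ) (G t z) :=
    ((measurable_indicator_Iic x).comp (hs.comp (hsh (d + 1)))).mul
      ((measurable_indicator_Iic y).comp ht)
  have hB : Measurable fun z : ℕ → ℝ => (Iic x).indicator (1 : ℝ → ℝ) (G s fun j => z (j + d)) :=
    (measurable_indicator_Iic x).comp (hs.comp (hsh d))
  have hpast : ∀ (i : ℤ) (m : ℕ) ω, (fun j => past ε (i + m) ω (j + m)) = past ε i ω := by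
    intro i m ω
    funext j
    simp only [past]
    congr 1
    push_cast
    ring
  -- The later time is moved to 1, where `condF` applies with conditioning on the past at time 0.
  have e1 : ∫ ω, (Iic x).indicator 1 (zeta ε G i s ω) *
        (Iic y).indicator 1 (zeta ε G (i + (d + 1)) t ω) ∂P =
      ∫ ω, (Iic x).indicator (1 : ℝ → ℝ) (G s fun j => past ε 0 ω (j + d)) *
        (Iic y).indicator 1 (zeta ε G 1 t ω) ∂P := by
    have h := ((identDistrib_past hε (i + (d + 1)) 1).comp hA).integral_eq
    have h1 : ∀ ω, (fun j => past ε (i + (d + 1)) ω (j + (d + 1))) = past ε i ω := fun ω => by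
      simpa using hpast i (d + 1) ω
    have h2 : ∀ ω, (fun j => past ε 1 ω (j + (d + 1))) = fun j => past ε 0 ω (j + d) := fun ω => by
      funext j
      simp only [past]
      congr 1
      push_cast
      ring
    simpa only [Function.comp, h1, h2, zeta] using h
  have e2 := integral_mul_indicator_zeta hε ht y hB fun z => hbd _ _
  -- A shift by d makes the earlier indicator a function of the past at 0 and `condF` one of the
  -- past at d, as `abs_cov_past_le` requires.
  have e3 : ∫ ω, (Iic x).indicator (1 : ℝ → ℝ) (G s fun j => past ε 0 ω (j + d)) *
        condF P ε G t y (past ε 0 ω) ∂P =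
      ∫ ω, (Iic x).indicator (1 : ℝ → ℝ) (G s (past ε 0 ω)) *
        condF P ε G t y (past ε d ω) ∂P := by
    have h := ((identDistrib_past hε 0 d).comp (hB.mul (measurable_condF (P := P) ε G t y))).integral_eq
    have h1 : ∀ ω, (fun j => past ε d ω (j + d)) = past ε 0 ω := fun ω => by
      simpa using hpast 0 d ω
    simpa only [Function.comp, h1, Pi.mul_apply] using h
  have e4 : ∫ ω, condF P ε G t y (past ε d ω) ∂P = distF P ε G t y := by
    have h := ((identDistrib_past hε d 0).comp (measurable_condF (P := P) ε G t y)).integral_eq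
    have h1 := integral_mul_indicator_zeta hε ht y (B := fun _ => 1) measurable_const (by simp)
    simp only [one_mul] at h1
    rw [integral_indicator_zeta hε ht] at h1
    rw [h1]
    exact h
  have e5 : ∫ ω, (Iic x).indicator (1 : ℝ → ℝ) (G s (past ε 0 ω)) ∂P = distF P ε G s x :=
    integral_indicator_zeta hε hs 0 x
  have hmain := abs_cov_past_le hε ((measurable_indicator_Iic x).comp hs)
    (measurable_condF (P := P) ε G t y) (fun z => hbd _ _)
    (fun z => by
      rw [abs_of_nonneg (condF_mem ε G t y z).1]; exact (condF_mem ε G t y z).2)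
    hC hχ0 hχ1 hdep d
  simp only [Function.comp] at hmain
  rw [e4, e5] at hmain
  rw [hexp, e1, e2, e3]
  exact hmain

/-- Under (A5), covariances of centred indicators decay geometrically, uniformly in the points. -/
lemma exists_abs_integral_centredInd_mul_le {P : Measure Ω} [IsProbabilityMeasure P]
    {ε : ℤ → Ω → ℝ} (hε : IsIID P ε) {G : ℝ → (ℕ → ℝ) → ℝ}
    (hG : ∀ t ∈ Icc (0 : ℝ) 1, Measurable (G t)) (hA5 : CondA5 P ε G) :
    ∃ C χ : ℝ, 0 < C ∧ 0 < χ ∧ χ < 1 ∧ ∀ s ∈ Icc (0 : ℝ) 1, ∀ t ∈ Icc (0 : ℝ) 1, ∀ x y : ℝ,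
      ∀ i j : ℕ, |∫ ω, centredInd P ε G i s x ω * centredInd P ε G j t y ω ∂P| ≤
        C * χ ^ (max i j - min i j) := by
  obtain ⟨χ, hχ0, hχ1, C, hC⟩ := hA5
  -- The constant in `UGMC` carries no sign, hence `max C 0`.
  have hdep : ∀ t ∈ Icc (0 : ℝ) 1, ∀ (y : ℝ) (k : ℕ),
      eLpNorm (fun ω : Ω × Ω => condF P ε G t y (past ε k ω.1) -
      condF P ε G t y (coupledPast ε k ω)) 4 (P.prod P) ≤ ENNReal.ofReal (max C 0 * χ ^ k) := by
    intro t ht y k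
    refine le_trans ?_ ((hC k).trans (ENNReal.ofReal_le_ofReal (by gcongr; exact le_max_left _ _)))
    exact le_trans (le_iSup (fun y : ℝ => eLpNorm (fun ω : Ω × Ω => condF P ε G t y (past ε k ω.1) -
      condF P ε G t y (coupledPast ε k ω)) 4 (P.prod P)) y)
      (le_iSup₂ (f := fun (t : ℝ) (_ : t ∈ Icc (0 : ℝ) 1) => ⨆ y : ℝ,
        eLpNorm (fun ω : Ω × Ω => condF P ε G t y (past ε k ω.1) -
      condF P ε G t y (coupledPast ε k ω)) 4 (P.prod P)) t ht)
  -- Conditioning uses up one time step, so lag d + 1 comes with the power χ^d; dividing by χ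
  -- compensates. The 1 later added to D covers the diagonal, where the integral is at most 1.
  set D : ℝ := max C 0 / (1 - χ) / χ with hDdef
  have hD : 0 ≤ D := div_nonneg (div_nonneg (le_max_right _ _) (by linarith)) hχ0.le
  have hlt : ∀ s ∈ Icc (0 : ℝ) 1, ∀ t ∈ Icc (0 : ℝ) 1, ∀ x y : ℝ,
      ∀ i j : ℕ, i < j → |∫ ω, centredInd P ε G i s x ω * centredInd P ε G j t y ω ∂P| ≤
        (D + 1) * χ ^ (j - i) := by
    intro s hs t ht x y i j hij
    obtain ⟨d, rfl⟩ := Nat.exists_eq_add_of_lt hij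
    have h := abs_integral_centredInd_mul_le hε (le_max_right C 0) hχ0.le hχ1 (hG s hs) (hG t ht)
      x y (hdep t ht y) i d
    have e : ((i + d + 1 : ℕ) : ℤ) = (i : ℤ) + ((d : ℤ) + 1) := by push_cast; ring
    have e' : i + d + 1 - i = d + 1 := by omega
    rw [e, e']
    refine h.trans ?_
    have : max C 0 / (1 - χ) * χ ^ d = D * χ ^ (d + 1) := by
      rw [hDdef, pow_succ]; field_simp
    rw [this]
    gcongr
    linarith
  refine ⟨D + 1, χ, by linarith, hχ0, hχ1, fun s hs t ht x y i j => ?_⟩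
  rcases lt_trichotomy i j with h | h | h
  · rw [max_eq_right h.le, min_eq_left h.le]
    exact hlt s hs t ht x y i j h
  · subst h
    simp only [max_self, min_self, Nat.sub_self, pow_zero, mul_one]
    refine le_trans (b := 1) ?_ (by linarith)
    refine abs_integral_le_integral_abs.trans ?_
    refine (integral_mono_of_nonneg (Eventually.of_forall fun ω => abs_nonneg _)
      (integrable_const (1 : ℝ)) (Eventually.of_forall fun ω => ?_)).trans (by simp)
    simp only [abs_mul]
    exact mul_le_one₀ (abs_centredInd_le ..) (abs_nonneg _) (abs_centredInd_le ..)
  · rw [max_eq_left h.le, min_eq_right h.le]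
    have := hlt t ht s hs y x j i h
    simpa only [mul_comm] using this

/-- Second moment of a weighted sum of variables with geometrically decaying covariances. -/
lemma integral_norm_sq_sum_le {P : Measure Ω} [IsProbabilityMeasure P] {E : Type*}
    [NormedAddCommGroup E] [InnerProductSpace ℝ E] {Y : ℕ → Ω → ℝ} {C χ B : ℝ}
    (hC : 0 ≤ C) (hχ0 : 0 ≤ χ) (hχ1 : χ < 1) (n : ℕ)
    (hY : ∀ i ∈ Finset.Icc 1 n, Measurable (Y i))
    (hY1 : ∀ i ∈ Finset.Icc 1 n, ∀ ω, |Y i ω| ≤ 1)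
    (hcov : ∀ i ∈ Finset.Icc 1 n, ∀ j ∈ Finset.Icc 1 n,
      |∫ ω, Y i ω * Y j ω ∂P| ≤ C * χ ^ (max i j - min i j))
    {v : ℕ → E} (hB : 0 ≤ B) (hv : ∀ i ∈ Finset.Icc 1 n, ‖v i‖ ≤ B) :
    ∫ ω, ‖∑ i ∈ Finset.Icc 1 n, Y i ω • v i‖ ^ 2 ∂P ≤ 2 * C / (1 - χ) * B ^ 2 * n := by
  have hexp : ∀ ω, ‖∑ i ∈ Finset.Icc 1 n, Y i ω • v i‖ ^ 2 =
      ∑ i ∈ Finset.Icc 1 n, ∑ j ∈ Finset.Icc 1 n, (Y i ω * Y j ω) * inner ℝ (v i) (v j) := by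
    intro ω
    rw [← real_inner_self_eq_norm_sq, sum_inner]
    refine Finset.sum_congr rfl fun i _ => ?_
    rw [inner_sum]
    refine Finset.sum_congr rfl fun j _ => ?_
    rw [inner_smul_left, inner_smul_right]
    simp
    ring
  have hint : ∀ i ∈ Finset.Icc 1 n, ∀ j ∈ Finset.Icc 1 n,
      Integrable (fun ω => (Y i ω * Y j ω) * inner ℝ (v i) (v j)) P := fun i hi j hj =>
    (integrable_of_abs_le ((hY i hi).mul (hY j hj)) (B := 1) fun ω => by
      rw [Pi.mul_apply, abs_mul]
      exact mul_le_one₀ (hY1 i hi ω) (abs_nonneg _) (hY1 j hj ω)).mul_const _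
  have hrow : ∀ i ∈ Finset.Icc 1 n, ∑ j ∈ Finset.Icc 1 n, χ ^ (max i j - min i j) ≤ 2 / (1 - χ) := by
    intro i _
    have hg : ∀ s : Finset ℕ, ∑ l ∈ s, χ ^ l ≤ (1 - χ)⁻¹ := fun s => by
      rw [← tsum_geometric_of_lt_one hχ0 hχ1]
      exact (summable_geometric_of_lt_one hχ0 hχ1).sum_le_tsum _ fun l _ => pow_nonneg hχ0 l
    -- On each side of the diagonal j ↦ |i - j| is injective, so each half row is a sum of distinct
    -- powers of χ.
    rw [← Finset.sum_filter_add_sum_filter_not _ (fun j => i ≤ j)]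
    have h1 : ∑ j ∈ Finset.Icc 1 n with i ≤ j, χ ^ (max i j - min i j) ≤ (1 - χ)⁻¹ := by
      refine le_trans (le_of_eq ?_) (hg ((Finset.Icc 1 n |>.filter (i ≤ ·)).image (· - i)))
      rw [Finset.sum_image]
      · refine Finset.sum_congr rfl fun j hj => ?_
        have := (Finset.mem_filter.1 hj).2
        rw [max_eq_right this, min_eq_left this]
      · intro a ha b hb h
        have := (Finset.mem_filter.1 ha).2
        have := (Finset.mem_filter.1 hb).2
        simp only at h
        omega
    have h2 : ∑ j ∈ Finset.Icc 1 n with ¬ i ≤ j, χ ^ (max i j - min i j) ≤ (1 - χ)⁻¹ := by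
      refine le_trans (le_of_eq ?_) (hg ((Finset.Icc 1 n |>.filter (¬ i ≤ ·)).image (i - ·)))
      rw [Finset.sum_image]
      · refine Finset.sum_congr rfl fun j hj => ?_
        have := (Finset.mem_filter.1 hj).2
        rw [max_eq_left (by omega), min_eq_right (by omega)]
      · intro a ha b hb h
        have := (Finset.mem_filter.1 ha).2
        have := (Finset.mem_filter.1 hb).2
        simp only at h
        omega
    calc _ ≤ (1 - χ)⁻¹ + (1 - χ)⁻¹ := add_le_add h1 h2
      _ = 2 / (1 - χ) := by ring
  simp_rw [hexp]
  rw [integral_finsetSum _ fun i hi => integrable_finsetSum _ fun j hj => hint i hi j hj]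
  calc ∑ i ∈ Finset.Icc 1 n, ∫ ω, ∑ j ∈ Finset.Icc 1 n, (Y i ω * Y j ω) * inner ℝ (v i) (v j) ∂P
      = ∑ i ∈ Finset.Icc 1 n, ∑ j ∈ Finset.Icc 1 n,
        (∫ ω, Y i ω * Y j ω ∂P) * inner ℝ (v i) (v j) := by
        refine Finset.sum_congr rfl fun i hi => ?_
        rw [integral_finsetSum _ fun j hj => hint i hi j hj]
        refine Finset.sum_congr rfl fun j _ => integral_mul_const _ _
    _ ≤ ∑ i ∈ Finset.Icc 1 n, ∑ j ∈ Finset.Icc 1 n, (C * χ ^ (max i j - min i j)) * B ^ 2 := by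
        refine Finset.sum_le_sum fun i hi => Finset.sum_le_sum fun j hj => ?_
        refine (le_abs_self _).trans ?_
        rw [abs_mul]
        refine mul_le_mul (hcov i hi j hj) ?_ (abs_nonneg _) (by positivity)
        refine (abs_real_inner_le_norm _ _).trans ?_
        rw [pow_two]
        exact mul_le_mul (hv i hi) (hv j hj) (norm_nonneg _) hB
    _ = C * B ^ 2 * ∑ i ∈ Finset.Icc 1 n, ∑ j ∈ Finset.Icc 1 n, χ ^ (max i j - min i j) := by
        simp only [Finset.mul_sum]
        exact Finset.sum_congr rfl fun i _ => Finset.sum_congr rfl fun j _ => by ring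
    _ ≤ C * B ^ 2 * ∑ i ∈ Finset.Icc 1 n, 2 / (1 - χ) := by
        gcongr with i hi
        exact hrow i hi
    _ = _ := by
        simp
        ring

/-! ### Check function: convexity, minimizers, increments. -/

lemma rho_convex {α : ℝ} (hα : α ∈ Ioo (0 : ℝ) 1) {a b : ℝ} (ha : 0 ≤ a) (hb : 0 ≤ b) (x y : ℝ) :
    rho α (a * x + b * y) ≤ a * rho α x + b * rho α y := by
  have h1 : max (a * x + b * y) 0 ≤ a * max x 0 + b * max y 0 :=
    max_le (add_le_add (mul_le_mul_of_nonneg_left (le_max_left _ _) ha)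
      (mul_le_mul_of_nonneg_left (le_max_left _ _) hb)) (by positivity)
  have h2 : max (-(a * x + b * y)) 0 ≤ a * max (-x) 0 + b * max (-y) 0 := by
    refine max_le ?_ (by positivity)
    have := mul_le_mul_of_nonneg_left (le_max_left (-x) 0) ha
    have := mul_le_mul_of_nonneg_left (le_max_left (-y) 0) hb
    linarith
  have := mul_le_mul_of_nonneg_left h1 hα.1.le
  have := mul_le_mul_of_nonneg_left h2 (sub_nonneg.2 hα.2.le)
  simp only [rho]
  linarith

lemma mul_abs_le_rho {α : ℝ} (x : ℝ) : min α (1 - α) * |x| ≤ rho α x := by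
  simp only [rho]
  rcases le_total 0 x with h | h
  · rw [abs_of_nonneg h, max_eq_left h, max_eq_right (by linarith), mul_zero, add_zero]
    exact mul_le_mul_of_nonneg_right (min_le_left _ _) h
  · rw [abs_of_nonpos h, max_eq_right h, max_eq_left (by linarith), mul_zero, zero_add]
    exact mul_le_mul_of_nonneg_right (min_le_right _ _) (by linarith)

lemma continuous_rho (α : ℝ) : Continuous (rho α) := by
  unfold rho
  fun_prop

lemma rho_nonneg {α : ℝ} (hα : α ∈ Ioo (0 : ℝ) 1) (x : ℝ) : 0 ≤ rho α x :=
  add_nonneg (mul_nonneg hα.1.le (le_max_right _ _))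
    (mul_nonneg (sub_nonneg.2 hα.2.le) (le_max_right _ _))

/-- The regression criterion attains its minimum, whether or not the design has full rank. -/
lemma exists_isMinOn_sum_rho {E : Type*} [NormedAddCommGroup E] [InnerProductSpace ℝ E]
    {α : ℝ} (hα : α ∈ Ioo (0 : ℝ) 1) (s : Finset ℕ) (X : ℕ → ℝ) (v : ℕ → E) :
    ∃ θ : E, IsMinOn (fun θ : E => ∑ i ∈ s, rho α (X i - inner ℝ θ (v i))) univ θ := by
  -- The criterion depends on θ only through the fitted values. On the range of L it is coercive,
  -- even when L has a kernel.
  let L : E →ₗ[ℝ] (s → ℝ) := LinearMap.pi fun i => (innerₗ E).flip (v i)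
  have hL : ∀ θ (i : s), L θ i = inner ℝ θ (v i) := fun θ i => rfl
  let Φ : LinearMap.range L → ℝ := fun w => ∑ i : s, rho α (X i - (w : s → ℝ) i)
  have hΦc : Continuous Φ := by
    refine continuous_finsetSum _ fun i _ => (continuous_rho α).comp (continuous_const.sub ?_)
    exact (continuous_apply i).comp continuous_subtype_val
  set m := min α (1 - α)
  have hm : 0 < m := lt_min hα.1 (sub_pos.2 hα.2)
  let X' : s → ℝ := fun i => X i
  have hlow : ∀ w : LinearMap.range L, m * (‖w‖ - ‖X'‖) ≤ Φ w := by
    intro w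
    have h1 : ‖X' - (w : s → ℝ)‖ ≤ Φ w / m := by
      refine (pi_norm_le_iff_of_nonneg (div_nonneg (Finset.sum_nonneg fun i _ => rho_nonneg hα _)
        hm.le)).2 fun i => ?_
      rw [le_div_iff₀' hm]
      exact (mul_abs_le_rho _).trans (Finset.single_le_sum (f := fun i : s =>
        rho α (X i - (w : s → ℝ) i)) (fun i _ => rho_nonneg hα _) (Finset.mem_univ i))
    have h2 : ‖w‖ - ‖X'‖ ≤ ‖X' - (w : s → ℝ)‖ := by
      rw [norm_sub_rev]; exact norm_sub_norm_le (w : s → ℝ) X'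
    rw [le_div_iff₀' hm] at h1
    exact (mul_le_mul_of_nonneg_left h2 hm.le).trans h1
  have hlim : Tendsto Φ (cocompact _) atTop := by
    refine tendsto_atTop_mono hlow ?_
    exact (tendsto_atTop_add_const_right _ (-‖X'‖)
      (tendsto_norm_cocompact_atTop (E := LinearMap.range L))).const_mul_atTop hm
  obtain ⟨⟨w, θ, rfl⟩, hw⟩ := hΦc.exists_forall_le hlim
  refine ⟨θ, fun θ' _ => ?_⟩
  have := hw ⟨L θ', θ', rfl⟩
  simp only [Φ, hL] at this
  have hs : ∀ θ : E, ∑ i : s, rho α (X i - inner ℝ θ (v i)) =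
      ∑ i ∈ s, rho α (X i - inner ℝ θ (v i)) := fun θ =>
    Finset.sum_coe_sort s fun i => rho α (X i - inner ℝ θ (v i))
  rw [hs, hs] at this
  exact this

/-- If the criterion is larger on a sphere than at its centre, its minimizers lie inside. -/
lemma norm_sub_le_of_isMinOn {Ω : Type*} {k : ℕ} {ε : ℤ → Ω → ℝ} {G : ℝ → (ℕ → ℝ) → ℝ}
    {g : ℝ → EuclideanSpace ℝ (Fin k)} {α : ℝ} (hα : α ∈ Ioo (0 : ℝ) 1) {n : ℕ} {ω : Ω}
    {θ θ₀ : EuclideanSpace ℝ (Fin k)} {R : ℝ} (hR : 0 ≤ R)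
    (hmin : IsMinOn (criterion ε G g α n ω) univ θ)
    (hsph : ∀ b : EuclideanSpace ℝ (Fin k), ‖b‖ = 1 →
      criterion ε G g α n ω θ₀ < criterion ε G g α n ω (θ₀ + R • b)) :
    ‖θ - θ₀‖ ≤ R := by
  by_contra! hlt
  set l := ‖θ - θ₀‖
  have hl : 0 < l := hR.trans_lt hlt
  have hb : ‖l⁻¹ • (θ - θ₀)‖ = 1 := by
    rw [norm_smul, norm_inv, Real.norm_of_nonneg hl.le]
    exact inv_mul_cancel₀ hl.ne'
  have h := hsph _ hb
  -- The segment from θ₀ to θ meets the sphere at weight a. There convexity keeps the criterion at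
  -- or below its value at θ₀, contradicting the hypothesis.
  set a := R / l
  have ha0 : 0 ≤ a := div_nonneg hR hl.le
  have ha1 : a ≤ 1 := (div_le_one hl).2 hlt.le
  have hpt : θ₀ + R • l⁻¹ • (θ - θ₀) = (1 - a) • θ₀ + a • θ := by
    rw [smul_smul, ← div_eq_mul_inv, smul_sub, sub_smul, one_smul]
    abel
  have hconv : criterion ε G g α n ω ((1 - a) • θ₀ + a • θ) ≤
      (1 - a) * criterion ε G g α n ω θ₀ + a * criterion ε G g α n ω θ := by
    simp only [criterion, Finset.mul_sum, ← Finset.sum_add_distrib]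
    refine Finset.sum_le_sum fun i _ => ?_
    refine le_trans (le_of_eq ?_) (rho_convex hα (sub_nonneg.2 ha1) ha0 _ _)
    rw [inner_add_left, inner_smul_left, inner_smul_left]
    congr 1
    simp
    ring
  have hle : criterion ε G g α n ω θ ≤ criterion ε G g α n ω θ₀ := hmin (mem_univ _)
  rw [hpt] at h
  nlinarith

/-- A lower bound for the increment of the check function: a linear term, a nonnegative
quadratic-type term at a nearby argument, and an error term supported near the kink. -/
lemma rho_sub_rho_ge (α z q u u' U : ℝ) (hu : |u| ≤ U) (hu' : |u'| ≤ U) :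
    -(u * (α - (Iic q).indicator 1 z))
      + u' / 2 * ((Iic (q + u' / 2)).indicator 1 z - (Iic q).indicator 1 z)
      - |u - u'| * ((Iic (q + U)).indicator 1 z - (Iic (q - U)).indicator 1 z)
      ≤ rho α (z - (q + u)) - rho α (z - q) := by
  -- The nonlinear part of the increment is ∫₀^u (1{e ≤ s} - 1{e ≤ 0}) ds. Moving the endpoint from
  -- u to u' costs at most |u - u'|, and nothing unless -U < e ≤ U. The integral up to u' is at
  -- least u'/2 times the integrand at u'/2, by monotonicity. The case analysis verifies the
  -- resulting bound.
  obtain ⟨e, rfl⟩ : ∃ e, z = q + e := ⟨z - q, by ring⟩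
  have hJ : ∀ x, (Iic (q + x)).indicator (1 : ℝ → ℝ) (q + e) = if e ≤ x then 1 else 0 := by
    intro x; simp [indicator, mem_Iic]
  have hJ0 := hJ 0
  have hJm := hJ (-U)
  rw [add_zero] at hJ0
  rw [← sub_eq_add_neg] at hJm
  rw [hJ0, hJm, hJ, hJ]
  have e1 : q + e - (q + u) = e - u := by ring
  have e2 : q + e - q = e := by ring
  rw [e1, e2]
  obtain ⟨hu1, hu2⟩ := abs_le.1 hu
  obtain ⟨hv1, hv2⟩ := abs_le.1 hu'
  have hd1 := le_abs_self (u - u')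
  have hd2 := neg_abs_le (u - u')
  generalize |u - u'| = D at *
  have hrho : ∀ x, rho α x = α * x + max (-x) 0 := by
    intro x
    have h := max_zero_sub_max_neg_zero_eq_self x
    simp only [rho]
    linear_combination α * h
  rw [hrho, hrho]
  have hred : u * (if e ≤ 0 then 1 else 0)
      + u' / 2 * ((if e ≤ u' / 2 then 1 else 0) - (if e ≤ 0 then 1 else 0))
      - D * ((if e ≤ U then 1 else 0) - (if e ≤ -U then 1 else 0))
      ≤ max (-(e - u)) 0 - max (-e) 0 := by
    rcases le_total 0 e with h2 | h2
    · rw [max_eq_right (by linarith : -e ≤ 0)]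
      have := le_max_left (-(e - u)) 0
      have := le_max_right (-(e - u)) 0
      split_ifs <;> linarith
    · rw [max_eq_left (by linarith : 0 ≤ -e)]
      have := le_max_left (-(e - u)) 0
      have := le_max_right (-(e - u)) 0
      split_ifs <;> linarith
  linarith

/-! ### Design: Riemann sums and nondegeneracy. -/

/-- Riemann sums of continuous functions converge. -/
lemma tendsto_riemann_sum {h : ℝ → ℝ} (hc : ContinuousOn h (Icc 0 1)) :
    Tendsto (fun n : ℕ => (∑ i ∈ Finset.Icc 1 n, h ((i : ℝ) / n)) / n) atTop
      (nhds (∫ t in (0 : ℝ)..1, h t)) := by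
  have huc := isCompact_Icc.uniformContinuousOn_of_continuous hc
  rw [Metric.uniformContinuousOn_iff] at huc
  rw [Metric.tendsto_atTop]
  intro η hη
  obtain ⟨δ, hδ, hunif⟩ := huc (η / 2) (by linarith)
  obtain ⟨N, hN⟩ := exists_nat_gt (1 / δ)
  refine ⟨N + 1, fun n hn => ?_⟩
  have hn0 : (0 : ℝ) < n := by exact_mod_cast (by omega : 0 < n)
  have hnδ : 1 / (n : ℝ) < δ := by
    have : (N : ℝ) < n := by exact_mod_cast (by omega : N < n)
    rw [div_lt_comm₀ hn0 hδ]
    linarith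
  have hmem : ∀ i : ℕ, i ≤ n → (i : ℝ) / n ∈ Icc (0 : ℝ) 1 := fun i hi =>
    ⟨by positivity, (div_le_one hn0).2 (by exact_mod_cast hi)⟩
  have hle : ∀ i : ℕ, (i : ℝ) / n ≤ ((i + 1 : ℕ) : ℝ) / n := fun i => by
    gcongr; simp
  have hII : ∀ i < n, IntervalIntegrable h volume ((i : ℝ) / n) (((i + 1 : ℕ) : ℝ) / n) := by
    intro i hi
    refine ContinuousOn.intervalIntegrable (hc.mono ?_)
    rw [uIcc_of_le (hle i)]
    exact Icc_subset_Icc (hmem i hi.le).1 (hmem (i + 1) hi).2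
  have hsum := intervalIntegral.sum_integral_adjacent_intervals
    (a := fun i : ℕ => (i : ℝ) / n) hII
  have hsum' : ∑ i ∈ Finset.range n, ∫ t in ((i : ℝ) / n)..(((i + 1 : ℕ) : ℝ) / n), h t =
      ∫ t in (0 : ℝ)..1, h t := by
    rw [hsum]
    simp [div_self hn0.ne']
  have hterm : ∀ i ∈ Finset.range n, ‖h (((i + 1 : ℕ) : ℝ) / n) / n -
      ∫ t in ((i : ℝ) / n)..(((i + 1 : ℕ) : ℝ) / n), h t‖ ≤ η / 2 * (1 / n) := by
    intro i hi
    have hi := Finset.mem_range.1 hi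
    have hlen : ((i + 1 : ℕ) : ℝ) / n - (i : ℝ) / n = 1 / n := by push_cast; ring
    have hconst : h (((i + 1 : ℕ) : ℝ) / n) / n =
        ∫ t in ((i : ℝ) / n)..(((i + 1 : ℕ) : ℝ) / n), h (((i + 1 : ℕ) : ℝ) / n) := by
      rw [intervalIntegral.integral_const, hlen, smul_eq_mul]; ring
    rw [hconst, ← intervalIntegral.integral_sub intervalIntegrable_const (hII i hi)]
    have := intervalIntegral.norm_integral_le_of_norm_le_const (C := η / 2)
      (f := fun t => h (((i + 1 : ℕ) : ℝ) / n) - h t)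
      (a := (i : ℝ) / n) (b := ((i + 1 : ℕ) : ℝ) / n) ?_
    · rwa [hlen, abs_of_pos (by positivity)] at this
    · intro t ht
      rw [uIoc_of_le (hle i)] at ht
      refine (hunif _ (hmem (i + 1) hi) t ⟨(hmem i hi.le).1.trans ht.1.le,
        ht.2.trans (hmem (i + 1) hi).2⟩ ?_).le
      rw [Real.dist_eq, abs_of_nonneg (sub_nonneg.2 ht.2)]
      linarith [ht.1]
  have hshift : (∑ i ∈ Finset.Icc 1 n, h ((i : ℝ) / n)) / n =
      ∑ i ∈ Finset.range n, h (((i + 1 : ℕ) : ℝ) / n) / n := by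
    rw [Finset.sum_div, Finset.range_eq_Ico, Finset.sum_Ico_add' (fun i : ℕ => h ((i : ℝ) / n) / n)]
    rfl
  rw [Real.dist_eq, hshift, ← hsum', ← Finset.sum_sub_distrib]
  calc |∑ i ∈ Finset.range n, (h (((i + 1 : ℕ) : ℝ) / n) / n -
        ∫ t in ((i : ℝ) / n)..(((i + 1 : ℕ) : ℝ) / n), h t)|
      ≤ ∑ i ∈ Finset.range n, η / 2 * (1 / n) :=
        (Finset.abs_sum_le_sum_abs _ _).trans (Finset.sum_le_sum hterm)
    _ = η / 2 := by simp; field_simp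
    _ < η := by linarith

/-- The design is uniformly nondegenerate over directions. -/
lemma exists_le_integral_inner_sq {k : ℕ} {g : ℝ → EuclideanSpace ℝ (Fin k)} (hB1 : CondB1 g) :
    ∃ c : ℝ, 0 < c ∧ ∀ b : EuclideanSpace ℝ (Fin k), ‖b‖ = 1 →
      c ≤ ∫ t in (0 : ℝ)..1, (inner ℝ b (g t)) ^ 2 := by
  obtain ⟨hg, hunit⟩ := hB1
  have hga : ∀ a, ContinuousOn (fun t => g t a) (Icc 0 1) := fun a =>
    (continuous_apply a).comp_continuousOn
      ((PiLp.continuous_ofLp 2 _).comp_continuousOn hg)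
  have hint : ∀ f : ℝ → ℝ, ContinuousOn f (Icc 0 1) → IntervalIntegrable f volume 0 1 := by
    intro f hf
    refine ContinuousOn.intervalIntegrable ?_
    rwa [uIcc_of_le zero_le_one]
  have hin : ∀ (b : EuclideanSpace ℝ (Fin k)) t, inner ℝ b (g t) = ∑ a, b a * g t a := by
    intro b t
    simp [PiLp.inner_apply, mul_comm]
  have hquad : ∀ b : EuclideanSpace ℝ (Fin k), ∫ t in (0 : ℝ)..1, (inner ℝ b (g t)) ^ 2 =
      ∑ a, ∑ a', b a * b a' * gram g a a' := by
    intro b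
    have : ∀ t, (inner ℝ b (g t)) ^ 2 = ∑ a, ∑ a', b a * b a' * (g t a * g t a') := by
      intro t
      rw [hin, pow_two, Finset.sum_mul_sum]
      exact Finset.sum_congr rfl fun a _ => Finset.sum_congr rfl fun a' _ => by ring
    simp_rw [this]
    rw [intervalIntegral.integral_finsetSum]
    · refine Finset.sum_congr rfl fun a _ => ?_
      rw [intervalIntegral.integral_finsetSum]
      · exact Finset.sum_congr rfl fun a' _ => intervalIntegral.integral_const_mul _ _
      · exact fun a' _ => (hint _ ((hga a).mul (hga a'))).const_mul _
    · intro a _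
      refine hint _ (continuousOn_finsetSum _ fun a' _ => ?_)
      exact continuousOn_const.mul ((hga a).mul (hga a'))
  have hcont : Continuous fun b : EuclideanSpace ℝ (Fin k) =>
      ∫ t in (0 : ℝ)..1, (inner ℝ b (g t)) ^ 2 := by
    simp_rw [hquad]
    fun_prop
  have hgin : ∀ b : EuclideanSpace ℝ (Fin k), ContinuousOn (fun t => inner ℝ b (g t)) (Icc 0 1) :=
    fun b => continuousOn_const.inner hg
  -- A vanishing integral would force b to be orthogonal to g on all of [0,1], by continuity, and
  -- `gram g` would then annihilate b.
  have hpos : ∀ b : EuclideanSpace ℝ (Fin k), ‖b‖ = 1 →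
      0 < ∫ t in (0 : ℝ)..1, (inner ℝ b (g t)) ^ 2 := by
    intro b hb
    by_contra hneg
    have hzero : ∀ t ∈ Icc (0 : ℝ) 1, inner ℝ b (g t) = 0 := by
      by_contra! hex
      obtain ⟨t, ht, hne⟩ := hex
      exact hneg (intervalIntegral.integral_pos zero_lt_one ((hgin b).pow 2)
        (fun x _ => sq_nonneg _) ⟨t, ht, by positivity⟩)
    have hmul : (gram g).mulVec b = 0 := by
      funext a
      have h1 : (gram g).mulVec b a = ∫ t in (0 : ℝ)..1, g t a * inner ℝ b (g t) := by
        simp only [Matrix.mulVec, dotProduct, gram, Matrix.of_apply]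
        simp_rw [hin, Finset.mul_sum]
        rw [intervalIntegral.integral_finsetSum]
        · refine Finset.sum_congr rfl fun a' _ => ?_
          rw [← intervalIntegral.integral_mul_const]
          congr 1
          funext t
          ring
        · exact fun a' _ => hint _ ((hga a).mul (continuousOn_const.mul (hga a')))
      rw [h1]
      have : ∫ t in (0 : ℝ)..1, g t a * inner ℝ b (g t) = ∫ t in (0 : ℝ)..1, (0 : ℝ) := by
        refine intervalIntegral.integral_congr fun t ht => ?_
        rw [uIcc_of_le zero_le_one] at ht
        simp [hzero t ht]
      rw [this]
      simp
    have hb0 : (b : Fin k → ℝ) = 0 := by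
      have := (Matrix.mulVec_injective_iff_isUnit.2 hunit) (hmul.trans (Matrix.mulVec_zero _).symm)
      exact this
    have : b = 0 := by ext a; exact congrFun hb0 a
    simp [this] at hb
  by_cases hne : (Metric.sphere (0 : EuclideanSpace ℝ (Fin k)) 1).Nonempty
  · obtain ⟨b₀, hb₀, hmin⟩ := (isCompact_sphere (0 : EuclideanSpace ℝ (Fin k)) 1).exists_isMinOn hne
      hcont.continuousOn
    exact ⟨_, hpos b₀ (by simpa using hb₀), fun b hb => hmin (by simpa using hb)⟩
  -- For k = 0 the unit sphere is empty and any constant serves.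
  · refine ⟨1, one_pos, fun b hb => ?_⟩
    exact absurd ⟨b, by simpa using hb⟩ hne

/-! ### Distribution functions near the quantile curve. -/

lemma distF_eq_map {P : Measure Ω} {ε : ℤ → Ω → ℝ} {G : ℝ → (ℕ → ℝ) → ℝ} {t : ℝ}
    (hz : Measurable (zeta ε G 0 t)) (x : ℝ) :
    distF P ε G t x = (P.map (zeta ε G 0 t)).real (Iic x) := by
  rw [map_measureReal_apply hz measurableSet_Iic]
  rfl

lemma distF_mono {P : Measure Ω} [IsProbabilityMeasure P] (ε : ℤ → Ω → ℝ) (G : ℝ → (ℕ → ℝ) → ℝ)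
    (t : ℝ) : Monotone (distF P ε G t) :=
  fun _ _ hab => measureReal_mono fun _ h => le_trans h hab

/-- Bounds on the density give bounds on the increments of the distribution function. -/
lemma distF_sub_distF_mem {P : Measure Ω} [IsProbabilityMeasure P] {ε : ℤ → Ω → ℝ}
    {G : ℝ → (ℕ → ℝ) → ℝ} {t : ℝ} (hz : Measurable (zeta ε G 0 t)) {f : ℝ → ℝ}
    (hf : P.map (zeta ε G 0 t) = volume.withDensity fun x => ENNReal.ofReal (f x))
    {a b m M : ℝ} (hab : a ≤ b) (hm0 : 0 ≤ m) (hm : ∀ x ∈ Icc a b, m ≤ f x)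
    (hM : ∀ x ∈ Icc a b, f x ≤ M) :
    distF P ε G t b - distF P ε G t a ∈ Icc (m * (b - a)) (M * (b - a)) := by
  have hM0 : 0 ≤ M := hm0.trans ((hm a ⟨le_rfl, hab⟩).trans (hM a ⟨le_rfl, hab⟩))
  have : IsProbabilityMeasure (P.map (zeta ε G 0 t)) :=
    Measure.isProbabilityMeasure_map hz.aemeasurable
  have h1 : distF P ε G t b - distF P ε G t a = (P.map (zeta ε G 0 t)).real (Ioc a b) := by
    have hset : Ioc a b = Iic b \ Iic a := by
      ext x
      simp [and_comm]
    rw [distF_eq_map hz, distF_eq_map hz, hset,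
      measureReal_sdiff (Iic_subset_Iic.2 hab) measurableSet_Iic]
  have h2 : (P.map (zeta ε G 0 t)) (Ioc a b) = ∫⁻ x in Ioc a b, ENNReal.ofReal (f x) := by
    rw [hf, withDensity_apply _ measurableSet_Ioc]
  have hlow : ENNReal.ofReal (m * (b - a)) ≤ (P.map (zeta ε G 0 t)) (Ioc a b) := by
    rw [h2, ENNReal.ofReal_mul hm0, ← Real.volume_Ioc, ← setLIntegral_const]
    exact setLIntegral_mono' measurableSet_Ioc fun x hx =>
      ENNReal.ofReal_le_ofReal (hm x (Ioc_subset_Icc_self hx))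
  have hup : (P.map (zeta ε G 0 t)) (Ioc a b) ≤ ENNReal.ofReal (M * (b - a)) := by
    rw [h2, ENNReal.ofReal_mul hM0, ← Real.volume_Ioc, ← setLIntegral_const]
    exact setLIntegral_mono' measurableSet_Ioc fun x hx =>
      ENNReal.ofReal_le_ofReal (hM x (Ioc_subset_Icc_self hx))
  rw [h1]
  refine ⟨?_, ENNReal.toReal_le_of_le_ofReal (mul_nonneg hM0 (sub_nonneg.2 hab)) hup⟩
  exact (ENNReal.ofReal_le_iff_le_toReal (measure_ne_top _ _)).1 hlow

/-- For a continuous distribution function, the quantile is a solution of `F(t, Q) = α`. -/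
lemma distF_quantile {P : Measure Ω} [IsProbabilityMeasure P] {ε : ℤ → Ω → ℝ}
    {G : ℝ → (ℕ → ℝ) → ℝ} {t : ℝ} (hz : Measurable (zeta ε G 0 t)) {α : ℝ}
    (hα : α ∈ Ioo (0 : ℝ) 1) (hc : Continuous (distF P ε G t)) :
    distF P ε G t (quantile P ε G α t) = α := by
  have : IsProbabilityMeasure (P.map (zeta ε G 0 t)) :=
    Measure.isProbabilityMeasure_map hz.aemeasurable
  have hcdf : distF P ε G t = cdf (P.map (zeta ε G 0 t)) := by
    funext x
    rw [cdf_eq_real, distF_eq_map hz]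
  have hbot : Tendsto (distF P ε G t) atBot (nhds 0) := hcdf ▸ tendsto_cdf_atBot _
  have htop : Tendsto (distF P ε G t) atTop (nhds 1) := hcdf ▸ tendsto_cdf_atTop _
  obtain ⟨a, ha⟩ := (hbot.eventually_lt_const hα.1).exists
  obtain ⟨b, hb⟩ := (htop.eventually_const_lt hα.2).exists
  obtain ⟨x₀, hx₀⟩ := mem_range_of_exists_le_of_exists_ge hc ⟨a, ha.le⟩ ⟨b, hb.le⟩
  have hbdd : BddBelow {x : ℝ | α ≤ distF P ε G t x} := by
    refine ⟨a, fun x hx => ?_⟩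
    by_contra! hlt
    exact absurd (hx.trans (distF_mono ε G t hlt.le)) (not_le.2 ha)
  have hcl : IsClosed {x : ℝ | α ≤ distF P ε G t x} := isClosed_le continuous_const hc
  refine le_antisymm ?_ (hcl.csInf_mem ⟨x₀, hx₀.ge⟩ hbdd)
  exact (distF_mono ε G t (csInf_le hbdd hx₀.ge)).trans hx₀.le

/-- Local behaviour of the distribution functions at the quantile curve, uniformly in `t`. -/
lemma exists_distF_local_bounds {P : Measure Ω} [IsProbabilityMeasure P] {ε : ℤ → Ω → ℝ}
    {G : ℝ → (ℕ → ℝ) → ℝ} {α : ℝ} (hα : α ∈ Ioo (0 : ℝ) 1)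
    (hz : ∀ t ∈ Icc (0 : ℝ) 1, Measurable (zeta ε G 0 t)) (hA1 : CondA1 P ε G α)
    {q : ℝ → ℝ} (hqc : ContinuousOn q (Icc 0 1))
    (hq : ∀ t ∈ Icc (0 : ℝ) 1, quantile P ε G α t = q t) :
    (∀ t ∈ Icc (0 : ℝ) 1, distF P ε G t (q t) = α) ∧
    ∃ c D r : ℝ, 0 < c ∧ 0 < D ∧ 0 < r ∧ ∀ t ∈ Icc (0 : ℝ) 1, ∀ u : ℝ, |u| ≤ r →
      c * u ^ 2 ≤ u * (distF P ε G t (q t + u) - distF P ε G t (q t)) ∧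
      u * (distF P ε G t (q t + u) - distF P ε G t (q t)) ≤ D * u ^ 2 := by
  obtain ⟨f, hf, ⟨K, hK⟩, c, hc, hcq⟩ := hA1
  have hLip : ∀ t ∈ Icc (0 : ℝ) 1, ∀ x y, |f t x - f t y| ≤ K * |x - y| := by
    intro t ht x y
    have := hK.dist_le_mul (t, x) ⟨ht, mem_univ _⟩ (t, y) ⟨ht, mem_univ _⟩
    simpa [Prod.dist_eq, Real.dist_eq] using this
  have hcont : ∀ t ∈ Icc (0 : ℝ) 1, Continuous (distF P ε G t) := by
    intro t ht
    rw [continuous_iff_continuousAt]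
    intro x₀
    -- A local bound on the density suffices: it makes the distribution function Lipschitz at x₀.
    have hM : ∀ x ∈ Icc (x₀ - 1) (x₀ + 1), f t x ≤ f t x₀ + K := by
      intro x hx
      have h1 := (le_abs_self _).trans (hLip t ht x x₀)
      have h2 : |x - x₀| ≤ 1 := abs_le.2 ⟨by linarith [hx.1], by linarith [hx.2]⟩
      have := mul_le_mul_of_nonneg_left h2 K.2
      simp only [NNReal.val_eq_coe] at this
      linarith
    refine continuousAt_of_locally_lipschitz (r := 1) one_pos (f t x₀ + K) fun y hy => ?_
    rw [Real.dist_eq] at hy ⊢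
    rw [Real.dist_eq]
    obtain ⟨hy1, hy2⟩ := abs_lt.1 hy
    rcases le_total x₀ y with h | h
    · have := distF_sub_distF_mem (hz t ht) (hf t ht).2 h le_rfl (fun x _ => (hf t ht).1 x)
        (fun x hx => hM x ⟨by linarith [hx.1], by linarith [hx.2]⟩)
      rw [abs_of_nonneg (by linarith [this.1]), abs_of_nonneg (by linarith)]
      exact this.2
    · have := distF_sub_distF_mem (hz t ht) (hf t ht).2 h le_rfl (fun x _ => (hf t ht).1 x)
        (fun x hx => hM x ⟨by linarith [hx.1], by linarith [hx.2]⟩)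
      rw [abs_sub_comm, abs_of_nonneg (by linarith [this.1]), abs_sub_comm,
        abs_of_nonneg (by linarith)]
      exact this.2
  refine ⟨fun t ht => by rw [← hq t ht]; exact distF_quantile (hz t ht) hα (hcont t ht), ?_⟩
  have hfq : ContinuousOn (fun t => f t (q t)) (Icc 0 1) := by
    have := hK.continuousOn.comp (continuousOn_id.prodMk hqc) fun t ht => ⟨ht, mem_univ _⟩
    exact this
  obtain ⟨C₀, hC₀⟩ := isCompact_Icc.exists_bound_of_continuousOn hfq
  have hC₀' : ∀ t ∈ Icc (0 : ℝ) 1, f t (q t) ≤ C₀ := fun t ht =>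
    (le_abs_self _).trans (hC₀ t ht)
  have hK0 : (0 : ℝ) ≤ K := K.2
  have hC0 : 0 < C₀ :=
    hc.trans_le ((hcq 0 (by simp)).trans (by rw [hq 0 (by simp)]; exact hC₀' 0 (by simp)))
  -- Within this radius the density varies by at most K r ≤ c/2, so it stays between c/2 and C₀ +
  -- c/2. Using K + 1 allows K = 0.
  set r : ℝ := c / (2 * (K + 1)) with hr
  have hrpos : 0 < r := by positivity
  have hKr : K * r ≤ c / 2 := by
    have : (K + 1) * r = c / 2 := by rw [hr]; field_simp
    nlinarith
  have hbd : ∀ t ∈ Icc (0 : ℝ) 1, ∀ x, |x - q t| ≤ r → c / 2 ≤ f t x ∧ f t x ≤ C₀ + c / 2 := by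
    intro t ht x hx
    have h1 := abs_le.1 ((hLip t ht x (q t)).trans
      ((mul_le_mul_of_nonneg_left hx hK0).trans hKr))
    have h2 := hcq t ht
    rw [hq t ht] at h2
    have h3 := hC₀' t ht
    constructor <;> linarith [h1.1, h1.2]
  refine ⟨c / 2, C₀ + c / 2, r, by linarith, by linarith, hrpos, fun t ht u hu => ?_⟩
  obtain ⟨hu1, hu2⟩ := abs_le.1 hu
  rcases le_total 0 u with h | h
  · have hb := distF_sub_distF_mem (hz t ht) (hf t ht).2 (a := q t) (b := q t + u) (m := c / 2)
      (M := C₀ + c / 2) (by linarith) (by linarith)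
      (fun x hx => (hbd t ht x (abs_le.2 ⟨by linarith [hx.1], by linarith [hx.2]⟩)).1)
      (fun x hx => (hbd t ht x (abs_le.2 ⟨by linarith [hx.1], by linarith [hx.2]⟩)).2)
    have h1 := mul_le_mul_of_nonneg_left hb.1 h
    have h2 := mul_le_mul_of_nonneg_left hb.2 h
    constructor <;> linarith
  · have hb := distF_sub_distF_mem (hz t ht) (hf t ht).2 (a := q t + u) (b := q t) (m := c / 2)
      (M := C₀ + c / 2) (by linarith) (by linarith)
      (fun x hx => (hbd t ht x (abs_le.2 ⟨by linarith [hx.1], by linarith [hx.2]⟩)).1)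
      (fun x hx => (hbd t ht x (abs_le.2 ⟨by linarith [hx.1], by linarith [hx.2]⟩)).2)
    have h1 := mul_le_mul_of_nonneg_left hb.1 (neg_nonneg.2 h)
    have h2 := mul_le_mul_of_nonneg_left hb.2 (neg_nonneg.2 h)
    constructor <;> linarith

/-! ### Score, curvature and kink count. -/

lemma natCast_div_mem_Icc {n i : ℕ} (hi : i ∈ Finset.Icc 1 n) : (i : ℝ) / n ∈ Icc (0 : ℝ) 1 := by
  obtain ⟨h1, h2⟩ := Finset.mem_Icc.1 hi
  have hn : (0 : ℝ) < n := by exact_mod_cast (by omega : 0 < n)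
  exact ⟨by positivity, (div_le_one hn).2 (by exact_mod_cast h2)⟩

/-- The score `∑ (1{X_i ≤ q(i/n)} - F(i/n, q(i/n))) g(i/n)`. -/
def score {k : ℕ} (P : Measure Ω) (ε : ℤ → Ω → ℝ) (G : ℝ → (ℕ → ℝ) → ℝ)
    (g : ℝ → EuclideanSpace ℝ (Fin k)) (q : ℝ → ℝ) (n : ℕ) (ω : Ω) : EuclideanSpace ℝ (Fin k) :=
  ∑ i ∈ Finset.Icc 1 n, centredInd P ε G i ((i : ℝ) / n) (q ((i : ℝ) / n)) ω • g ((i : ℝ) / n)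

/-- A lower bound for the nonlinear part of the criterion, with local parameters `u (i/n)`. -/
def curvature (ε : ℤ → Ω → ℝ) (G : ℝ → (ℕ → ℝ) → ℝ) (q u : ℝ → ℝ) (n : ℕ) (ω : Ω) : ℝ :=
  ∑ i ∈ Finset.Icc 1 n, u ((i : ℝ) / n) / 2 *
    ((Iic (q ((i : ℝ) / n) + u ((i : ℝ) / n) / 2)).indicator 1 (zeta ε G i ((i : ℝ) / n) ω)
      - (Iic (q ((i : ℝ) / n))).indicator 1 (zeta ε G i ((i : ℝ) / n) ω))

/-- The number of observations within distance `U` of the quantile curve. -/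
def kinkCount (ε : ℤ → Ω → ℝ) (G : ℝ → (ℕ → ℝ) → ℝ) (q : ℝ → ℝ) (n : ℕ) (U : ℝ) (ω : Ω) : ℝ :=
  ∑ i ∈ Finset.Icc 1 n,
    ((Iic (q ((i : ℝ) / n) + U)).indicator 1 (zeta ε G i ((i : ℝ) / n) ω)
      - (Iic (q ((i : ℝ) / n) - U)).indicator 1 (zeta ε G i ((i : ℝ) / n) ω))

/-- Deterministic lower bound for the increment of the criterion. -/
lemma criterion_sub_ge {k : ℕ} {P : Measure Ω} {ε : ℤ → Ω → ℝ} {G : ℝ → (ℕ → ℝ) → ℝ}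
    {g : ℝ → EuclideanSpace ℝ (Fin k)} {θ₀ : EuclideanSpace ℝ (Fin k)} {α B R δ : ℝ} {q : ℝ → ℝ}
    (hq : ∀ t ∈ Icc (0 : ℝ) 1, inner ℝ θ₀ (g t) = q t)
    (hF : ∀ t ∈ Icc (0 : ℝ) 1, distF P ε G t (q t) = α)
    (hB : ∀ t ∈ Icc (0 : ℝ) 1, ‖g t‖ ≤ B) (hB0 : 0 ≤ B) (hR : 0 ≤ R)
    {b b' : EuclideanSpace ℝ (Fin k)} (hb : ‖b‖ = 1) (hb' : ‖b'‖ = 1) (hbb : ‖b - b'‖ ≤ δ)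
    (n : ℕ) (ω : Ω) :
    -(R * ‖score P ε G g q n ω‖) + curvature ε G q (fun t => R * inner ℝ b' (g t)) n ω
      - δ * (R * B * kinkCount ε G q n (R * B) ω) ≤
    criterion ε G g α n ω (θ₀ + R • b) - criterion ε G g α n ω θ₀ := by
  have hin : ∀ c : EuclideanSpace ℝ (Fin k), ‖c‖ = 1 → ∀ t ∈ Icc (0 : ℝ) 1,
      |R * inner ℝ c (g t)| ≤ R * B := by
    intro c hc t ht
    rw [abs_mul, abs_of_nonneg hR]
    refine mul_le_mul_of_nonneg_left ((abs_real_inner_le_norm _ _).trans ?_) hR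
    rw [hc, one_mul]
    exact hB t ht
  have hlin : -(R * ‖score P ε G g q n ω‖) ≤ R * inner ℝ b (score P ε G g q n ω) := by
    have h := (abs_le.1 (abs_real_inner_le_norm b (score P ε G g q n ω))).1
    rw [hb, one_mul] at h
    have := mul_le_mul_of_nonneg_left h hR
    linarith
  refine le_trans (b := R * inner ℝ b (score P ε G g q n ω) +
    curvature ε G q (fun t => R * inner ℝ b' (g t)) n ω
      - δ * (R * B * kinkCount ε G q n (R * B) ω)) (by linarith) ?_
  simp only [score, curvature, kinkCount, criterion, inner_sum, Finset.mul_sum,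
    ← Finset.sum_add_distrib, ← Finset.sum_sub_distrib]
  refine Finset.sum_le_sum fun i hi => ?_
  have ht := natCast_div_mem_Icc hi
  set t : ℝ := (i : ℝ) / n
  have hJ : (0 : ℝ) ≤ (Iic (q t + R * B)).indicator 1 (zeta ε G i t ω)
      - (Iic (q t - R * B)).indicator 1 (zeta ε G i t ω) := by
    have hRB : 0 ≤ R * B := mul_nonneg hR hB0
    refine sub_nonneg.2 (indicator_le_indicator_of_subset (Iic_subset_Iic.2 (by linarith))
      (fun _ => zero_le_one) _)
  have hdiff : |R * inner ℝ b (g t) - R * inner ℝ b' (g t)| ≤ δ * (R * B) := by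
    rw [← mul_sub, ← inner_sub_left, abs_mul, abs_of_nonneg hR]
    have h1 := (abs_real_inner_le_norm (b - b') (g t)).trans
      (mul_le_mul hbb (hB t ht) (norm_nonneg _) ((norm_nonneg _).trans hbb))
    have := mul_le_mul_of_nonneg_left h1 hR
    linarith
  have hmain := rho_sub_rho_ge α (zeta ε G i t ω) (q t) (R * inner ℝ b (g t))
    (R * inner ℝ b' (g t)) (R * B) (hin b hb t ht) (hin b' hb' t ht)
  have hobs : obs ε G n i ω = zeta ε G i t ω := rfl
  have hmul := mul_le_mul_of_nonneg_right hdiff hJ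
  rw [hobs, inner_add_left, inner_smul_left, hq t ht, inner_smul_right]
  simp only [conj_trivial]
  simp only [centredInd, hF t ht]
  linarith

lemma measure_ge_le_ofReal {P : Measure Ω} [IsProbabilityMeasure P] {f : Ω → ℝ}
    (hf0 : ∀ ω, 0 ≤ f ω) (hf : Integrable f P) {s p : ℝ} (hs : 0 < s)
    (h : ∫ ω, f ω ∂P ≤ s * p) : P {ω | s ≤ f ω} ≤ ENNReal.ofReal p := by
  have h1 := mul_meas_ge_le_integral_of_nonneg (μ := P) (Eventually.of_forall hf0) hf s
  have h2 : P.real {ω | s ≤ f ω} ≤ p := le_of_mul_le_mul_left (h1.trans h) hs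
  rw [← ofReal_measureReal]
  exact ENNReal.ofReal_le_ofReal h2

/-! ### Moments of the three terms. -/

section Moments

variable {P : Measure Ω} [IsProbabilityMeasure P] {ε : ℤ → Ω → ℝ} {G : ℝ → (ℕ → ℝ) → ℝ}

lemma integral_curvature (hε : IsIID P ε) (hG : ∀ t ∈ Icc (0 : ℝ) 1, Measurable (G t))
    (q u : ℝ → ℝ) (n : ℕ) :
    ∫ ω, curvature ε G q u n ω ∂P = ∑ i ∈ Finset.Icc 1 n, u ((i : ℝ) / n) / 2 *
      (distF P ε G ((i : ℝ) / n) (q ((i : ℝ) / n) + u ((i : ℝ) / n) / 2) -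
        distF P ε G ((i : ℝ) / n) (q ((i : ℝ) / n))) := by
  have hi' := fun i (hi : i ∈ Finset.Icc 1 n) x => integrable_indicator_zeta (P := P)
    hε.measurable (hG _ (natCast_div_mem_Icc hi)) i x
  simp only [curvature]
  rw [integral_finsetSum]
  swap
  · exact fun i hi => ((hi' i hi _).sub (hi' i hi _)).const_mul _
  refine Finset.sum_congr rfl fun i hi => ?_
  rw [integral_const_mul, integral_sub (hi' i hi _) (hi' i hi _),
    integral_indicator_zeta hε (hG _ (natCast_div_mem_Icc hi)),
    integral_indicator_zeta hε (hG _ (natCast_div_mem_Icc hi))]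

lemma integrable_kinkCount (hε : IsIID P ε) (hG : ∀ t ∈ Icc (0 : ℝ) 1, Measurable (G t))
    (q : ℝ → ℝ) (n : ℕ) (U : ℝ) : Integrable (kinkCount ε G q n U) P :=
  integrable_finsetSum _ fun i hi =>
    (integrable_indicator_zeta hε.measurable (hG _ (natCast_div_mem_Icc hi)) i _).sub
      (integrable_indicator_zeta hε.measurable (hG _ (natCast_div_mem_Icc hi)) i _)

lemma kinkCount_nonneg {Ω : Type*} (ε : ℤ → Ω → ℝ) (G : ℝ → (ℕ → ℝ) → ℝ) (q : ℝ → ℝ) (n : ℕ)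
    {U : ℝ} (hU : 0 ≤ U) (ω : Ω) : 0 ≤ kinkCount ε G q n U ω :=
  Finset.sum_nonneg fun i _ => sub_nonneg.2
    (indicator_le_indicator_of_subset (Iic_subset_Iic.2 (by linarith)) (fun _ => zero_le_one) _)

lemma integral_kinkCount (hε : IsIID P ε) (hG : ∀ t ∈ Icc (0 : ℝ) 1, Measurable (G t))
    (q : ℝ → ℝ) (n : ℕ) (U : ℝ) :
    ∫ ω, kinkCount ε G q n U ω ∂P = ∑ i ∈ Finset.Icc 1 n,
      (distF P ε G ((i : ℝ) / n) (q ((i : ℝ) / n) + U) -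
        distF P ε G ((i : ℝ) / n) (q ((i : ℝ) / n) - U)) := by
  have hi' := fun i (hi : i ∈ Finset.Icc 1 n) x => integrable_indicator_zeta (P := P)
    hε.measurable (hG _ (natCast_div_mem_Icc hi)) i x
  simp only [kinkCount]
  rw [integral_finsetSum]
  swap
  · exact fun i hi => (hi' i hi _).sub (hi' i hi _)
  refine Finset.sum_congr rfl fun i hi => ?_
  rw [integral_sub (hi' i hi _) (hi' i hi _),
    integral_indicator_zeta hε (hG _ (natCast_div_mem_Icc hi)),
    integral_indicator_zeta hε (hG _ (natCast_div_mem_Icc hi))]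

variable {C χ : ℝ}

/-- Second moments of weighted sums of centred indicators along the design. -/
lemma integral_norm_sq_sum_centredInd_le {E : Type*} [NormedAddCommGroup E]
    [InnerProductSpace ℝ E] (hε : IsIID P ε) (hG : ∀ t ∈ Icc (0 : ℝ) 1, Measurable (G t))
    (hC : 0 ≤ C) (hχ0 : 0 ≤ χ) (hχ1 : χ < 1)
    (hcov : ∀ s ∈ Icc (0 : ℝ) 1, ∀ t ∈ Icc (0 : ℝ) 1, ∀ x y : ℝ, ∀ i j : ℕ,
      |∫ ω, centredInd P ε G i s x ω * centredInd P ε G j t y ω ∂P| ≤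
        C * χ ^ (max i j - min i j))
    (x : ℝ → ℝ) {v : ℝ → E} {B : ℝ} (hB : 0 ≤ B) (hv : ∀ t ∈ Icc (0 : ℝ) 1, ‖v t‖ ≤ B) (n : ℕ) :
    ∫ ω, ‖∑ i ∈ Finset.Icc 1 n, centredInd P ε G i ((i : ℝ) / n) (x ((i : ℝ) / n)) ω •
      v ((i : ℝ) / n)‖ ^ 2 ∂P ≤ 2 * C / (1 - χ) * B ^ 2 * n :=
  integral_norm_sq_sum_le (P := P)
    (Y := fun i => centredInd P ε G i ((i : ℝ) / n) (x ((i : ℝ) / n)))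
    (v := fun i => v ((i : ℝ) / n)) hC hχ0 hχ1 n
    (fun _ hi => measurable_centredInd hε.measurable (hG _ (natCast_div_mem_Icc hi)) _ _)
    (fun _ _ _ => abs_centredInd_le ..)
    (fun i hi j hj => hcov _ (natCast_div_mem_Icc hi) _ (natCast_div_mem_Icc hj) _ _ i j)
    hB fun _ hi => hv _ (natCast_div_mem_Icc hi)

lemma measurable_sum_centredInd {P : Measure Ω} {E : Type*} [NormedAddCommGroup E] [NormedSpace ℝ E]
    (hε : IsIID P ε) (hG : ∀ t ∈ Icc (0 : ℝ) 1, Measurable (G t)) (x : ℝ → ℝ) (v : ℝ → E) (n : ℕ) :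
    StronglyMeasurable fun ω => ∑ i ∈ Finset.Icc 1 n,
      centredInd P ε G i ((i : ℝ) / n) (x ((i : ℝ) / n)) ω • v ((i : ℝ) / n) :=
  Finset.stronglyMeasurable_fun_sum _ fun _ hi => StronglyMeasurable.smul_const
    (measurable_centredInd hε.measurable (hG _ (natCast_div_mem_Icc hi)) _ _).stronglyMeasurable _

lemma integrable_norm_sq_sum_centredInd {E : Type*} [NormedAddCommGroup E] [NormedSpace ℝ E]
    (hε : IsIID P ε) (hG : ∀ t ∈ Icc (0 : ℝ) 1, Measurable (G t)) (x : ℝ → ℝ) (v : ℝ → E) (n : ℕ) :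
    Integrable (fun ω => ‖∑ i ∈ Finset.Icc 1 n,
      centredInd P ε G i ((i : ℝ) / n) (x ((i : ℝ) / n)) ω • v ((i : ℝ) / n)‖ ^ 2) P := by
  refine integrable_of_abs_le ((measurable_sum_centredInd hε hG x v n).norm.measurable.pow_const 2)
    (B := (∑ i ∈ Finset.Icc 1 n, ‖v ((i : ℝ) / n)‖) ^ 2) fun ω => ?_
  rw [abs_of_nonneg (sq_nonneg _)]
  gcongr
  refine (norm_sum_le _ _).trans (Finset.sum_le_sum fun i _ => ?_)
  rw [norm_smul]
  exact mul_le_of_le_one_left (norm_nonneg _) (abs_centredInd_le ..)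

/-- Centring splits the curvature into a difference of two weighted sums of centred indicators, with
weights at most U/2; (x - y)² ≤ 2x² + 2y² then gives the constant of one sum with weights U. The
closeness of the two thresholds is not exploited: with U = RB the bound is of order M², already
negligible against the squared mean, of order M⁴. -/
lemma integrable_sq_and_integral_sq_curvature_le (hε : IsIID P ε)
    (hG : ∀ t ∈ Icc (0 : ℝ) 1, Measurable (G t))
    (hC : 0 ≤ C) (hχ0 : 0 ≤ χ) (hχ1 : χ < 1)
    (hcov : ∀ s ∈ Icc (0 : ℝ) 1, ∀ t ∈ Icc (0 : ℝ) 1, ∀ x y : ℝ, ∀ i j : ℕ,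
      |∫ ω, centredInd P ε G i s x ω * centredInd P ε G j t y ω ∂P| ≤
        C * χ ^ (max i j - min i j))
    (q u : ℝ → ℝ) {U : ℝ} (hU : 0 ≤ U) (hu : ∀ t ∈ Icc (0 : ℝ) 1, |u t| ≤ U) (n : ℕ) :
    Integrable (fun ω => (curvature ε G q u n ω - ∫ ω', curvature ε G q u n ω' ∂P) ^ 2) P ∧
    ∫ ω, (curvature ε G q u n ω - ∫ ω', curvature ε G q u n ω' ∂P) ^ 2 ∂P ≤
      2 * C / (1 - χ) * U ^ 2 * n := by
  set A₁ : Ω → ℝ := fun ω => ∑ i ∈ Finset.Icc 1 n,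
    centredInd P ε G i ((i : ℝ) / n) (q ((i : ℝ) / n) + u ((i : ℝ) / n) / 2) ω •
      (u ((i : ℝ) / n) / 2) with hA₁
  set A₂ : Ω → ℝ := fun ω => ∑ i ∈ Finset.Icc 1 n,
    centredInd P ε G i ((i : ℝ) / n) (q ((i : ℝ) / n)) ω • (u ((i : ℝ) / n) / 2) with hA₂
  have hdec : ∀ ω, curvature ε G q u n ω - ∫ ω', curvature ε G q u n ω' ∂P = A₁ ω - A₂ ω := by
    intro ω
    rw [integral_curvature hε hG]
    simp only [curvature, hA₁, hA₂, ← Finset.sum_sub_distrib]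
    refine Finset.sum_congr rfl fun i _ => ?_
    simp only [centredInd, smul_eq_mul]
    ring
  have hu2 : ∀ t ∈ Icc (0 : ℝ) 1, ‖u t / 2‖ ≤ U / 2 := fun t ht => by
    rw [norm_div, Real.norm_eq_abs, Real.norm_ofNat]
    linarith [hu t ht]
  have h1 := integral_norm_sq_sum_centredInd_le hε hG hC hχ0 hχ1 hcov (fun t => q t + u t / 2)
    (v := fun t => u t / 2) (by linarith) hu2 n
  have h2 := integral_norm_sq_sum_centredInd_le hε hG hC hχ0 hχ1 hcov q
    (v := fun t => u t / 2) (by linarith) hu2 n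
  have i1 := integrable_norm_sq_sum_centredInd hε hG (fun t => q t + u t / 2)
    (fun t => u t / 2) n
  have i2 := integrable_norm_sq_sum_centredInd hε hG q (fun t => u t / 2) n
  have m1 := measurable_sum_centredInd hε hG (fun t => q t + u t / 2) (fun t => u t / 2) n
  have m2 := measurable_sum_centredInd hε hG q (fun t => u t / 2) n
  simp only [Real.norm_eq_abs, sq_abs] at h1 h2 i1 i2
  have hle : ∀ ω, (A₁ ω - A₂ ω) ^ 2 ≤ 2 * A₁ ω ^ 2 + 2 * A₂ ω ^ 2 := fun ω => by
    nlinarith [sq_nonneg (A₁ ω + A₂ ω)]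
  have hint : Integrable (fun ω => 2 * A₁ ω ^ 2 + 2 * A₂ ω ^ 2) P :=
    (i1.const_mul 2).add (i2.const_mul 2)
  simp_rw [hdec]
  have hI : Integrable (fun ω => (A₁ ω - A₂ ω) ^ 2) P := by
    refine hint.mono' ((m1.sub m2).measurable.pow_const 2).aestronglyMeasurable
      (Eventually.of_forall fun ω => ?_)
    rw [Real.norm_eq_abs, abs_of_nonneg (sq_nonneg _)]
    exact hle ω
  refine ⟨hI, (integral_mono hI hint hle).trans ?_⟩
  rw [integral_add (i1.const_mul 2) (i2.const_mul 2), integral_const_mul, integral_const_mul]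
  calc _ ≤ 2 * (2 * C / (1 - χ) * (U / 2) ^ 2 * n) + 2 * (2 * C / (1 - χ) * (U / 2) ^ 2 * n) := by
        gcongr
    _ = _ := by ring

end Moments

/-! ### Positivity on the sphere and √n-consistency. -/

set_option maxHeartbeats 400000 in
/-- The increments of the criterion on a sphere of radius `M n^{-1/2}` are positive with high
probability, hence minimizers are `√n`-consistent. -/
lemma isBigOP_norm_sub {P : Measure Ω} [IsProbabilityMeasure P] {ε : ℤ → Ω → ℝ}
    (hε : IsIID P ε) {G : ℝ → (ℕ → ℝ) → ℝ} (hG : ∀ t ∈ Icc (0 : ℝ) 1, Measurable (G t))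
    {α : ℝ} (hα : α ∈ Ioo (0 : ℝ) 1) {k : ℕ} {g : ℝ → EuclideanSpace ℝ (Fin k)}
    {θ₀ : EuclideanSpace ℝ (Fin k)}
    (hQ : ∀ t ∈ Icc (0 : ℝ) 1, quantile P ε G α t = inner ℝ θ₀ (g t))
    (hA1 : CondA1 P ε G α) (hA5 : CondA5 P ε G) (hB1 : CondB1 g)
    {θhat : ℕ → Ω → EuclideanSpace ℝ (Fin k)}
    (hmin : ∀ n : ℕ, 1 ≤ n → ∀ᵐ ω ∂P, IsMinOn (criterion ε G g α n ω) univ (θhat n ω)) :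
    IsBigOP P (fun n ω => ‖θhat n ω - θ₀‖) (fun n => (n : ℝ) ^ (-(1 / 2) : ℝ)) := by
  intro η hη
  set q : ℝ → ℝ := fun t => inner ℝ θ₀ (g t) with hq
  have hqc : ContinuousOn q (Icc 0 1) := continuousOn_const.inner hB1.1
  obtain ⟨hF, c, D, r, hc, hD, hr, hloc⟩ := exists_distF_local_bounds hα
    (fun t ht => measurable_zeta hε.measurable (hG t ht) 0) hA1 hqc hQ
  obtain ⟨C, χ, hC, hχ0, hχ1, hcov⟩ := exists_abs_integral_centredInd_mul_le hε hG hA5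
  obtain ⟨c₀, hc₀, hgram⟩ := exists_le_integral_inner_sq hB1
  obtain ⟨B', hB'⟩ := isCompact_Icc.exists_bound_of_continuousOn hB1.1
  set B := max B' 1
  have hB : ∀ t ∈ Icc (0 : ℝ) 1, ‖g t‖ ≤ B := fun t ht => (hB' t ht).trans (le_max_left _ _)
  have hBpos : 0 < B := lt_max_of_lt_right one_pos
  set V := 2 * C / (1 - χ) with hV
  have hVpos : 0 < V := div_pos (by linarith) (by linarith)
  -- κM² will bound the mean curvature from below: c/4 comes from the midpoint u/2, and c₀/2 from
  -- the Riemann sums for large n.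
  set κ := c * c₀ / 8 with hκ
  have hκpos : 0 < κ := by positivity
  -- Chosen so that 2δDB²M² = (κM²/4)(η/3), which is Markov's inequality for the net error. It
  -- involves neither M nor n, so the net may be fixed before both.
  set δ := κ * η / (24 * D * B ^ 2) with hδ
  have hδpos : 0 < δ := by positivity
  obtain ⟨net, hnet, hnetfin, hcover⟩ :=
    (isCompact_sphere (0 : EuclideanSpace ℝ (Fin k)) 1).finite_cover_balls hδpos
  lift net to Finset (EuclideanSpace ℝ (Fin k)) using hnetfin
  have hnet1 : ∀ b ∈ net, ‖b‖ = 1 := fun b hb => by simpa using hnet hb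
  set N : ℝ := (net.card : ℝ)
  have hN : 0 ≤ N := Nat.cast_nonneg _
  -- The squared norm of the score, of mean at most VB²n, exceeds a²n with probability at most η/3.
  set a := Real.sqrt (3 * V * B ^ 2 / η) with ha
  have hapos : 0 < a := Real.sqrt_pos.2 (by positivity)
  have ha2 : a ^ 2 = 3 * V * B ^ 2 / η := Real.sq_sqrt (by positivity)
  -- Failure probability allowed at each net point; N + 1 permits an empty net.
  set p := η / (3 * (N + 1)) with hp
  have hppos : 0 < p := by positivity
  -- The first term makes the score negligible (Ma < κM²/4), the last controls the curvature
  -- fluctuations by Chebyshev's inequality, and the 1 gives M ≤ M².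
  set M := 4 * a / κ + 1 + 4 * V * B ^ 2 / (κ ^ 2 * p) with hM
  have hM1 : 1 ≤ M := by
    have : 0 ≤ 4 * a / κ := by positivity
    have : 0 ≤ 4 * V * B ^ 2 / (κ ^ 2 * p) := by positivity
    linarith
  have hMpos : 0 < M := by linarith
  have hMa : M * a < κ * M ^ 2 / 4 := by
    have h0 : 0 ≤ 4 * V * B ^ 2 / (κ ^ 2 * p) := by positivity
    have h1 : 4 * a / κ < M := by linarith
    rw [div_lt_iff₀ hκpos] at h1
    nlinarith
  have hMV : V * B ^ 2 * M ^ 2 ≤ (κ * M ^ 2 / 2) ^ 2 * p := by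
    have h0 : 0 ≤ 4 * a / κ := by positivity
    have h1 : 4 * V * B ^ 2 / (κ ^ 2 * p) ≤ M ^ 2 := by nlinarith
    rw [div_le_iff₀ (by positivity)] at h1
    have := mul_le_mul_of_nonneg_right h1 (sq_nonneg M)
    nlinarith
  clear_value M p a δ κ V
  refine ⟨M, ?_⟩
  have hrate : Tendsto (fun n : ℕ => M * (n : ℝ) ^ (-(1 / 2) : ℝ) * B) atTop (nhds 0) := by
    have h := ((tendsto_rpow_neg_atTop (y := 1 / 2) (by norm_num)).comp
      tendsto_natCast_atTop_atTop).const_mul M |>.mul_const B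
    simpa using h
  have hdesign : ∀ᶠ n : ℕ in atTop, ∀ b ∈ net,
      c₀ / 2 < (∑ i ∈ Finset.Icc 1 n, (inner ℝ b (g ((i : ℝ) / n))) ^ 2) / n := by
    rw [Filter.eventually_all_finset]
    intro b hb
    have hcb : ContinuousOn (fun t => (inner ℝ b (g t)) ^ 2) (Icc 0 1) :=
      (continuousOn_const.inner hB1.1).pow 2
    exact (tendsto_riemann_sum hcb).eventually_const_lt
      (by linarith [hgram b (hnet1 b hb)])
  filter_upwards [hrate.eventually_lt_const hr, hdesign, eventually_ge_atTop 1] with n hnr hnd hn1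
  set R := M * (n : ℝ) ^ (-(1 / 2) : ℝ) with hR
  have hn0 : (0 : ℝ) < n := by exact_mod_cast hn1
  have hRpos : 0 < R := mul_pos hMpos (Real.rpow_pos_of_pos hn0 _)
  have hR2 : R ^ 2 * n = M ^ 2 := by
    have : ((n : ℝ) ^ (-(1 / 2) : ℝ)) ^ 2 = (n : ℝ)⁻¹ := by
      rw [← Real.rpow_natCast, ← Real.rpow_mul hn0.le, ← Real.rpow_neg_one]
      norm_num
    rw [hR, mul_pow, this, mul_assoc, inv_mul_cancel₀ hn0.ne', mul_one]
  clear_value R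
  set u : EuclideanSpace ℝ (Fin k) → ℝ → ℝ := fun b t => R * inner ℝ b (g t) with hu
  have hub : ∀ b ∈ net, ∀ t ∈ Icc (0 : ℝ) 1, |u b t| ≤ R * B := by
    intro b hb t ht
    simp only [hu]
    rw [abs_mul, abs_of_pos hRpos]
    refine mul_le_mul_of_nonneg_left ((abs_real_inner_le_norm _ _).trans ?_) hRpos.le
    rw [hnet1 b hb, one_mul]
    exact hB t ht
  set E₁ : Set Ω := {ω | a ^ 2 * n ≤ ‖score P ε G g q n ω‖ ^ 2}
  set E₂ : EuclideanSpace ℝ (Fin k) → Set Ω := fun b => {ω | (κ * M ^ 2 / 2) ^ 2 ≤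
    (curvature ε G q (u b) n ω - ∫ ω', curvature ε G q (u b) n ω' ∂P) ^ 2}
  set E₃ : Set Ω := {ω | κ * M ^ 2 / 4 ≤ δ * (R * B * kinkCount ε G q n (R * B) ω)}
  set E₄ : Set Ω := {ω | ¬ IsMinOn (criterion ε G g α n ω) univ (θhat n ω)}
  have hRB : 0 ≤ R * B := by positivity
  have hE₁ : P E₁ ≤ ENNReal.ofReal (η / 3) := by
    refine measure_ge_le_ofReal (fun ω => sq_nonneg _)
      (integrable_norm_sq_sum_centredInd hε hG q g n) (by positivity) ?_
    refine (integral_norm_sq_sum_centredInd_le hε hG hC.le hχ0.le hχ1 hcov q hBpos.le hB n).trans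
      (le_of_eq ?_)
    rw [ha2, ← hV]
    field_simp
  have hE₂ : ∀ b ∈ net, P (E₂ b) ≤ ENNReal.ofReal p := by
    intro b hb
    obtain ⟨hi, hle⟩ := integrable_sq_and_integral_sq_curvature_le hε hG hC.le hχ0.le hχ1 hcov q
      (u b) hRB (hub b hb) n
    refine measure_ge_le_ofReal (fun ω => sq_nonneg _) hi (by positivity) (hle.trans ?_)
    have : V * (R * B) ^ 2 * n = V * B ^ 2 * M ^ 2 := by rw [← hR2]; ring
    rw [← hV, this]
    exact hMV
  have hE₃ : P E₃ ≤ ENNReal.ofReal (η / 3) := by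
    refine measure_ge_le_ofReal (fun ω => mul_nonneg hδpos.le (mul_nonneg hRB
      (kinkCount_nonneg ε G q n hRB ω)))
      (((integrable_kinkCount hε hG q n (R * B)).const_mul _).const_mul _) (by positivity) ?_
    rw [integral_const_mul, integral_const_mul, integral_kinkCount hε hG, Finset.mul_sum]
    have hterm : ∀ i ∈ Finset.Icc 1 n, R * B *
        (distF P ε G ((i : ℝ) / n) (q ((i : ℝ) / n) + R * B) -
        distF P ε G ((i : ℝ) / n) (q ((i : ℝ) / n) - R * B)) ≤ 2 * D * (R * B) ^ 2 := by
      intro i hi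
      have ht := natCast_div_mem_Icc hi
      have h1 := (hloc _ ht (R * B) (by rw [abs_of_nonneg hRB]; exact hnr.le)).2
      have h2 := (hloc _ ht (-(R * B)) (by rw [abs_neg, abs_of_nonneg hRB]; exact hnr.le)).2
      rw [← sub_eq_add_neg] at h2
      linarith
    have hsum := Finset.sum_le_sum hterm
    rw [Finset.sum_const, Nat.card_Icc, nsmul_eq_mul, Nat.add_sub_cancel] at hsum
    refine (mul_le_mul_of_nonneg_left hsum hδpos.le).trans (le_of_eq ?_)
    have : (n : ℝ) * (2 * D * (R * B) ^ 2) = 2 * D * B ^ 2 * M ^ 2 := by rw [← hR2]; ring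
    rw [this, hδ]
    field_simp
    ring
  have hE₄ : P E₄ = 0 := hmin n hn1
  have hmean : ∀ b ∈ net, κ * M ^ 2 ≤ ∫ ω, curvature ε G q (u b) n ω ∂P := by
    intro b hb
    rw [integral_curvature hε hG]
    have hterm : ∀ i ∈ Finset.Icc 1 n, c / 4 * R ^ 2 * (inner ℝ b (g ((i : ℝ) / n))) ^ 2 ≤
        u b ((i : ℝ) / n) / 2 *
      (distF P ε G ((i : ℝ) / n) (q ((i : ℝ) / n) + u b ((i : ℝ) / n) / 2) -
        distF P ε G ((i : ℝ) / n) (q ((i : ℝ) / n))) := by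
      intro i hi
      have ht := natCast_div_mem_Icc hi
      refine le_trans (le_of_eq ?_) (hloc _ ht (u b ((i : ℝ) / n) / 2) ?_).1
      · simp only [hu]; ring
      · rw [abs_div, abs_two]
        have := hub b hb _ ht
        have := abs_nonneg (u b ((i : ℝ) / n))
        linarith
    refine le_trans ?_ (Finset.sum_le_sum hterm)
    rw [← Finset.mul_sum]
    have hd := (lt_div_iff₀ hn0).1 (hnd b hb)
    calc κ * M ^ 2 = c / 4 * R ^ 2 * (c₀ / 2 * n) := by rw [← hR2, hκ]; ring
      _ ≤ _ := by gcongr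
  have hsub : {ω | R < |‖θhat n ω - θ₀‖|} ⊆ E₁ ∪ (⋃ b ∈ net, E₂ b) ∪ E₃ ∪ E₄ := by
    intro ω hω
    by_contra hnot
    simp only [mem_union, mem_iUnion, not_or, not_exists] at hnot
    obtain ⟨⟨⟨h1, h2⟩, h3⟩, h4⟩ := hnot
    have h1 : ‖score P ε G g q n ω‖ ^ 2 < a ^ 2 * n := not_le.1 h1
    have h3 : δ * (R * B * kinkCount ε G q n (R * B) ω) < κ * M ^ 2 / 4 := not_le.1 h3
    have h4 : IsMinOn (criterion ε G g α n ω) univ (θhat n ω) := not_not.1 h4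
    have hscore : R * ‖score P ε G g q n ω‖ < M * a := by
      refine lt_of_pow_lt_pow_left₀ 2 (by positivity) ?_
      calc (R * ‖score P ε G g q n ω‖) ^ 2 = R ^ 2 * ‖score P ε G g q n ω‖ ^ 2 := by ring
        _ < R ^ 2 * (a ^ 2 * n) := by gcongr
        _ = (M * a) ^ 2 := by linear_combination a ^ 2 * hR2
    have hin : ‖θhat n ω - θ₀‖ ≤ R := by
      refine norm_sub_le_of_isMinOn hα hRpos.le h4 fun b hb => ?_
      have hbs : b ∈ Metric.sphere (0 : EuclideanSpace ℝ (Fin k)) 1 := by simpa using hb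
      obtain ⟨b', hb', hbb⟩ := mem_iUnion₂.1 (hcover hbs)
      have hb' : b' ∈ net := hb'
      have hcurv : |curvature ε G q (u b') n ω - ∫ ω', curvature ε G q (u b') n ω' ∂P| <
          κ * M ^ 2 / 2 :=
        abs_lt_of_sq_lt_sq (not_le.1 (h2 b' hb')) (by positivity)
      -- Off the exceptional events the increment exceeds κM²(-1/4 + 1 - 1/2 - 1/4) = 0: score, mean
      -- curvature, its fluctuation, net error.
      have hlow := criterion_sub_ge (P := P) (q := q) (δ := δ) (fun t _ => rfl) hF hB hBpos.le hRpos.le hb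
        (hnet1 b' hb') (by rw [← dist_eq_norm]; exact (Metric.mem_ball.1 hbb).le) n ω
      have := (abs_lt.1 hcurv).1
      have := hmean b' hb'
      linarith
    rw [mem_ofPred_eq, abs_of_nonneg (norm_nonneg _)] at hω
    exact absurd hω (not_lt.2 hin)
  have hunion : P (⋃ b ∈ net, E₂ b) ≤ ENNReal.ofReal (η / 3) := by
    refine (measure_biUnion_finset_le net E₂).trans ((Finset.sum_le_sum hE₂).trans ?_)
    rw [Finset.sum_const, nsmul_eq_mul, ← ENNReal.ofReal_natCast,
      ← ENNReal.ofReal_mul (Nat.cast_nonneg _)]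
    refine ENNReal.ofReal_le_ofReal ?_
    change N * p ≤ η / 3
    have : (N + 1) * p = η / 3 := by rw [hp]; field_simp
    nlinarith
  calc P {ω | R < |‖θhat n ω - θ₀‖|} ≤ P (E₁ ∪ (⋃ b ∈ net, E₂ b) ∪ E₃ ∪ E₄) := measure_mono hsub
    _ ≤ P E₁ + P (⋃ b ∈ net, E₂ b) + P E₃ + P E₄ :=
        (measure_union_le _ _).trans (add_le_add_left ((measure_union_le _ _).trans
          (add_le_add_left (measure_union_le _ _) _)) _)
    _ ≤ ENNReal.ofReal (η / 3) + ENNReal.ofReal (η / 3) + ENNReal.ofReal (η / 3) + 0 := by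
        rw [hE₄]
        gcongr
    _ = ENNReal.ofReal η := by
        rw [add_zero, ← ENNReal.ofReal_add (by positivity) (by positivity),
          ← ENNReal.ofReal_add (by positivity) (by positivity)]
        congr 1
        ring

end QuantReg

end

theorem proposition1 {Ω : Type*} [MeasurableSpace Ω] (P : Measure Ω) [IsProbabilityMeasure P]
    (ε : ℤ → Ω → ℝ) (hε : QuantReg.IsIID P ε)
    (G : ℝ → (ℕ → ℝ) → ℝ) (hG : ∀ t ∈ Icc (0 : ℝ) 1, Measurable (G t))
    (α : ℝ) (hα : α ∈ Ioo (0 : ℝ) 1)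
    {k : ℕ} (g : ℝ → EuclideanSpace ℝ (Fin k)) (θ₀ : EuclideanSpace ℝ (Fin k))
    (hQ : ∀ t ∈ Icc (0 : ℝ) 1, QuantReg.quantile P ε G α t = inner ℝ θ₀ (g t))
    (hA1 : QuantReg.CondA1 P ε G α) (hA5 : QuantReg.CondA5 P ε G) (hB1 : QuantReg.CondB1 g) :
    (∀ (n : ℕ) (ω : Ω), ∃ θ, IsMinOn (QuantReg.criterion ε G g α n ω) univ θ) ∧
    ∀ θhat : ℕ → Ω → EuclideanSpace ℝ (Fin k),
      (∀ n : ℕ, 1 ≤ n → ∀ᵐ ω ∂P, IsMinOn (QuantReg.criterion ε G g α n ω) univ (θhat n ω)) →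
      QuantReg.IsBigOP P (fun n ω => ‖θhat n ω - θ₀‖) (fun n => (n : ℝ) ^ (-(1 / 2) : ℝ)) :=
  ⟨fun n ω => QuantReg.exists_isMinOn_sum_rho hα (Finset.Icc 1 n)
    (fun i => QuantReg.obs ε G n i ω) (fun i => g ((i : ℝ) / n)),
  fun _ hmin => QuantReg.isBigOP_norm_sub hε hG hα hQ hA1 hA5 hB1 hmin⟩
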